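/- Let $\Gamma$ be a finite group acting faithfully and linearly on a finite-dimensional real vector space $V$. For $\gamma\in\Gamma$ let $V^\gamma$ be the fixed subspace, $l(\gamma)=\operatorname{codim}_{\mathbb R} V^\gamma$, and let $N^\gamma\subseteq V$ be the subspace on which all $\gamma$-fixed elements of $V^*$ vanish (the orthogonal complement of $V^\gamma$ for any $\Gamma$-invariant metric). A constant Poisson structure on $S(V^*)\rtimes\Gamma$ is an element $$\pi=\pi_0+\sum_{l(\gamma)=2}\pi_\gamma\in(\wedge^2V)^\Gamma\oplus\Big(\bigoplus_{l(\gamma)=2}\wedge^2N^\gamma\Big)^\Gamma ,$$ where $\Gamma$-invariance means $g\cdot\pi_0=\pi_0$ and $g\cdot\pi_\gamma=\pi_{g\gamma g^{-1}}$ for all $g,\gamma\in\Gamma$. Let $I_\pi$ be the two-sided ideal of $(T(V^*)\rtimes\Gamma)[[\hbar]]$ generated by the elements $$x\otimes y-y\otimes x-\hbar\Big(\pi_0(x,y)+\sum_{l(\gamma)=2}\pi_\gamma(x,y)\,\gamma\Big),\qquad x,y\in V^*,$$ let $\overline{I_\pi}=\bigcap_n\big(I_\pi+(\hbar^n)\big)$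 be its $\hbar$-adic closure, and let $H_\pi=(T(V^*)\rtimes\Gamma)[[\hbar]]/\overline{I_\pi}$. A formal deformation of a real algebra $A$ is a unital associative $\mathbb R[[\hbar]]$-bilinear product on $A[[\hbar]]$, with unit $1$, determined by $a\star b=ab+\sum_{n\ge1}\hbar^nB_n(a,b)$ for $a,b\in A$, where the $B_n:A\times A\to A$ are bilinear; that is, $f\star g=\sum\hbar^{i+j+k}B_i(f_j,g_k)$ with $B_0$ the product of $A$. For $A=S(V^*)\rtimes\Gamma$ it is said to quantize $\pi$ if the class of $B_1$ in the Hochschild cohomology $H^2(A,A)$ is that of $\pi$, i.e. if $B_1$ differs by a Hochschild coboundary from a bilinear map $c$ with $c(\gamma a,b)=\gamma c(a,b)$, $c(a\gamma,b)=c(a,\gamma b)$, $c(a,b\gamma)=c(a,b)\gamma$ for $\gamma\in\Gamma$, $a,b\in A$, and $c(x,y)-c(y,x)=\pi_0(x,y)+\sum_\gamma\pi_\gamma(x,y)\gamma$ for $x,y\in V^*$. Then, for every constant Poisson structure $\pi$ on $S(V^*)\rtimes\Gamma$: 1. $\pi$ is quantizable: there is a formal deformation of $S(V^*)\rtimes\Gamma$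 that quantizes $\pi$. 2. $(T(V^*)\rtimes\Gamma)[[\hbar]]/I_\pi$ and $H_\pi$ have the PBW property: for the filtration whose $n$-th term is the image of the power series with coefficients in the span of the elements $x_1\otimes\cdots\otimes x_i\,\gamma$ with $i\le n$, the associated graded algebra is isomorphic, as an $\mathbb R[[\hbar]]$-algebra, to $\mathbb R[[\hbar]]\otimes_{\mathbb R}\big(S(V^*)\rtimes\Gamma\big)$, by an isomorphism that sends the symbols of $x\in V^*$ and $\gamma\in\Gamma$ to $1\otimes x$ and $1\otimes\gamma$. 3. $H_\pi$ is a deformation quantization of $S(V^*)\rtimes\Gamma$ with respect to $\pi$: there are a formal deformation $\star$ of $S(V^*)\rtimes\Gamma$ that quantizes $\pi$ and an isomorphism of $\mathbb R[[\hbar]]$-algebras $\big((S(V^*)\rtimes\Gamma)[[\hbar]],\star\big)\cong H_\pi$ under which the class of every $t\in T(V^*)\rtimes\Gamma$ corresponds modulo $\hbar$ to the image of $t$ in $S(V^*)\rtimes\Gamma$. -/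

import Mathlib

open scoped TensorProduct PowerSeries

noncomputable section

namespace OrbifoldPBW

/-! ### Crossed products

`SkewMonoidAlgebra R Γ` is the crossed product `R ⋊ Γ`: finite sums of `r γ`
(`SkewMonoidAlgebra.single γ r`) with `(r γ)(s δ) = r (γ • s) γδ`. -/

section CrossedProduct

variable {Γ R : Type*} [Group Γ] [Ring R] [Algebra ℝ R] [MulSemiringAction Γ R]
  [SMulCommClass Γ ℝ R]

/-- `R ⋊ Γ` is a real algebra when `Γ` acts on `R` by real algebra automorphisms. -/
instance crossAlgebra : Algebra ℝ (SkewMonoidAlgebra R Γ) :=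
  Algebra.ofModule
    (fun r f g => by
      simp only [SkewMonoidAlgebra.mul_def, SkewMonoidAlgebra.sum_def,
        SkewMonoidAlgebra.coeff_smul]
      rw [Finsupp.sum_smul_index' (by intro i; simp [Finsupp.sum]), Finsupp.smul_sum]
      refine Finsupp.sum_congr fun i _ => ?_
      rw [Finsupp.smul_sum]
      refine Finsupp.sum_congr fun j _ => ?_
      rw [SkewMonoidAlgebra.smul_single, smul_mul_assoc])
    (fun r f g => by
      simp only [SkewMonoidAlgebra.mul_def, SkewMonoidAlgebra.sum_def,
        SkewMonoidAlgebra.coeff_smul]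
      rw [Finsupp.smul_sum]
      refine Finsupp.sum_congr fun i _ => ?_
      rw [Finsupp.sum_smul_index' (by intro i; simp), Finsupp.smul_sum]
      refine Finsupp.sum_congr fun j _ => ?_
      rw [SkewMonoidAlgebra.smul_single, smul_comm, mul_smul_comm])

/-- `(R ⋊ Γ)[[ħ]]` is an algebra over `ℝ[[ħ]]`. The formal parameter `ħ` is `PowerSeries.X`. -/
instance crossPowerSeriesAlgebra : Algebra ℝ⟦X⟧ (SkewMonoidAlgebra R Γ)⟦X⟧ :=
  RingHom.toAlgebra' (PowerSeries.map (algebraMap ℝ (SkewMonoidAlgebra R Γ))) (by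
    intro c f
    ext1 n
    rw [PowerSeries.coeff_mul, PowerSeries.coeff_mul, ← Finset.Nat.sum_antidiagonal_swap]
    refine Finset.sum_congr rfl fun p _ => ?_
    simp only [PowerSeries.coeff_map, Prod.fst_swap, Prod.snd_swap]
    exact Algebra.commutes _ _)

end CrossedProduct

/-! ### Associated graded algebra of a filtered algebra -/

/-- An increasing multiplicative filtration `F 0 ⊆ F 1 ⊆ ⋯` of a `k`-algebra. -/
structure AlgFiltration (k A : Type*) [CommRing k] [Ring A] [Algebra k A] where
  deg : ℕ → Submodule k A
  mono : Monotone deg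
  one_mem : (1 : A) ∈ deg 0
  mul_mem : ∀ {m n : ℕ} {a b : A}, a ∈ deg m → b ∈ deg n → a * b ∈ deg (m + n)

namespace AlgFiltration

variable {k A : Type*} [CommRing k] [Ring A] [Algebra k A] (F : AlgFiltration k A)

/-- The Rees algebra `⨁ₙ F n · tⁿ`, inside `A[t]`. -/
def rees : Subalgebra k (Polynomial A) where
  carrier := {p | ∀ n, p.coeff n ∈ F.deg n}
  mul_mem' := by
    intro p q hp hq n
    rw [Polynomial.coeff_mul]
    refine Submodule.sum_mem _ fun x hx => ?_
    have := F.mul_mem (hp x.1) (hq x.2)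
    rwa [Finset.HasAntidiagonal.mem_antidiagonal.mp hx] at this
  add_mem' := by
    intro p q hp hq n
    rw [Polynomial.coeff_add]
    exact Submodule.add_mem _ (hp n) (hq n)
  algebraMap_mem' := by
    intro r n
    rw [Polynomial.algebraMap_apply, Polynomial.coeff_C]
    split_ifs with h
    · subst h
      rw [Algebra.algebraMap_eq_smul_one]
      exact Submodule.smul_mem _ _ F.one_mem
    · exact Submodule.zero_mem _

/-- `F (n - 1)`, with `F (-1) = 0`. -/
def pred : ℕ → Submodule k A
  | 0 => ⊥
  | n + 1 => F.deg n

lemma mul_mem_pred_left {m n : ℕ} {a b : A} (ha : a ∈ F.deg m) (hb : b ∈ F.pred n) :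
    a * b ∈ F.pred (m + n) := by
  cases n with
  | zero =>
    have : b = 0 := by simpa [pred] using hb
    simp [this]
  | succ n => exact F.mul_mem ha hb

lemma mul_mem_pred_right {m n : ℕ} {a b : A} (ha : a ∈ F.pred m) (hb : b ∈ F.deg n) :
    a * b ∈ F.pred (m + n) := by
  cases m with
  | zero =>
    have : a = 0 := by simpa [pred] using ha
    simp [this]
  | succ m =>
    have := F.mul_mem (m := m) ha hb
    rwa [show m + 1 + n = (m + n) + 1 by omega]

/-- The two-sided ideal `⨁ₙ F (n - 1) · tⁿ` of the Rees algebra. -/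
def lower : TwoSidedIdeal F.rees :=
  TwoSidedIdeal.mk' {p | ∀ n, (p : Polynomial A).coeff n ∈ F.pred n}
    (fun n => by simp)
    (fun {p q} hp hq n => by
      simpa using Submodule.add_mem _ (hp n) (hq n))
    (fun {p} hp n => by
      simpa using hp n)
    (fun {p q} hq n => by
      change ((p : Polynomial A) * (q : Polynomial A)).coeff n ∈ _
      rw [Polynomial.coeff_mul]
      refine Submodule.sum_mem _ fun x hx => ?_
      have := F.mul_mem_pred_left (p.2 x.1) (hq x.2)
      rwa [Finset.HasAntidiagonal.mem_antidiagonal.mp hx] at this)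
    (fun {p q} hp n => by
      change ((p : Polynomial A) * (q : Polynomial A)).coeff n ∈ _
      rw [Polynomial.coeff_mul]
      refine Submodule.sum_mem _ fun x hx => ?_
      have := F.mul_mem_pred_right (hp x.1) (q.2 x.2)
      rwa [Finset.HasAntidiagonal.mem_antidiagonal.mp hx] at this)

/-- The associated graded algebra `⨁ₙ F n / F (n - 1)`, as the quotient of `⨁ₙ F n · tⁿ` by
`⨁ₙ F (n - 1) · tⁿ`. -/
abbrev Gr : Type _ := F.lower.ringCon.Quotient

/-- The class of `a ∈ F n` in `F n / F (n - 1) ⊆ Gr`. -/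
def symbol (n : ℕ) (a : F.deg n) : F.Gr :=
  F.lower.ringCon.mk' ⟨Polynomial.monomial n (a : A), fun m => by
    rw [Polynomial.coeff_monomial]
    split_ifs with h
    · exact h ▸ a.2
    · exact Submodule.zero_mem _⟩

end AlgFiltration

/-! ### The algebras `T(V*)`, `S(V*)` and their crossed products with `Γ` -/

variable {Γ V : Type*} [Group Γ] [AddCommGroup V] [Module ℝ V]

/-- The tensor algebra `T(V*)`, carrying the `Γ`-action induced by `ρ`. -/
def TDual (_ρ : Representation ℝ Γ V) : Type _ := TensorAlgebra ℝ (Module.Dual ℝ V)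

/-- The symmetric algebra `S(V*)`, carrying the `Γ`-action induced by `ρ`. -/
def SDual (_ρ : Representation ℝ Γ V) : Type _ := SymmetricAlgebra ℝ (Module.Dual ℝ V)

variable (ρ : Representation ℝ Γ V)

instance : Ring (TDual ρ) := inferInstanceAs (Ring (TensorAlgebra ℝ (Module.Dual ℝ V)))
instance : Algebra ℝ (TDual ρ) := inferInstanceAs (Algebra ℝ (TensorAlgebra ℝ (Module.Dual ℝ V)))
instance : CommRing (SDual ρ) := inferInstanceAs (CommRing (SymmetricAlgebra ℝ (Module.Dual ℝ V)))
instance : Algebra ℝ (SDual ρ) :=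
  inferInstanceAs (Algebra ℝ (SymmetricAlgebra ℝ (Module.Dual ℝ V)))

/-- The inclusion `V* → T(V*)`. -/
def TDual.ι : Module.Dual ℝ V →ₗ[ℝ] TDual ρ := TensorAlgebra.ι ℝ

/-- The inclusion `V* → S(V*)`. -/
def SDual.ι : Module.Dual ℝ V →ₗ[ℝ] SDual ρ := SymmetricAlgebra.ι ℝ (Module.Dual ℝ V)

/-- The quotient map `T(V*) → S(V*)`. -/
def TDual.toSDual : TDual ρ →ₐ[ℝ] SDual ρ := SymmetricAlgebra.algHom ℝ (Module.Dual ℝ V)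

/-- The algebra endomorphism of `T(V*)` extending the action of `γ` on `V*`. -/
def TDual.act (γ : Γ) : TDual ρ →ₐ[ℝ] TDual ρ :=
  TensorAlgebra.lift ℝ (TDual.ι ρ ∘ₗ ρ.dual γ)

/-- The algebra endomorphism of `S(V*)` extending the action of `γ` on `V*`. -/
def SDual.act (γ : Γ) : SDual ρ →ₐ[ℝ] SDual ρ :=
  SymmetricAlgebra.lift (SDual.ι ρ ∘ₗ ρ.dual γ)

lemma TDual.act_ι (γ : Γ) (x : Module.Dual ℝ V) :
    TDual.act ρ γ (TDual.ι ρ x) = TDual.ι ρ (ρ.dual γ x) :=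
  TensorAlgebra.lift_ι_apply _ _

lemma SDual.act_ι (γ : Γ) (x : Module.Dual ℝ V) :
    SDual.act ρ γ (SDual.ι ρ x) = SDual.ι ρ (ρ.dual γ x) :=
  SymmetricAlgebra.lift_ι_apply _ _

lemma TDual.act_one : TDual.act ρ 1 = AlgHom.id ℝ _ :=
  TensorAlgebra.hom_ext (LinearMap.ext fun x => by
    refine (TDual.act_ι ρ 1 x).trans ?_
    rw [map_one]; rfl)

lemma TDual.act_mul (γ δ : Γ) : TDual.act ρ (γ * δ) = (TDual.act ρ γ).comp (TDual.act ρ δ) :=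
  TensorAlgebra.hom_ext (LinearMap.ext fun x => by
    refine (TDual.act_ι ρ (γ * δ) x).trans ?_
    refine Eq.trans ?_ (congrArg (TDual.act ρ γ) (TDual.act_ι ρ δ x)).symm
    rw [TDual.act_ι, map_mul]; rfl)

lemma SDual.act_one : SDual.act ρ 1 = AlgHom.id ℝ _ :=
  SymmetricAlgebra.algHom_ext (LinearMap.ext fun x => by
    refine (SDual.act_ι ρ 1 x).trans ?_
    rw [map_one]; rfl)

lemma SDual.act_mul (γ δ : Γ) : SDual.act ρ (γ * δ) = (SDual.act ρ γ).comp (SDual.act ρ δ) :=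
  SymmetricAlgebra.algHom_ext (LinearMap.ext fun x => by
    refine (SDual.act_ι ρ (γ * δ) x).trans ?_
    refine Eq.trans ?_ (congrArg (SDual.act ρ γ) (SDual.act_ι ρ δ x)).symm
    rw [SDual.act_ι, map_mul]; rfl)

instance : MulSemiringAction Γ (TDual ρ) where
  smul γ t := TDual.act ρ γ t
  one_smul t := congrArg (fun f : TDual ρ →ₐ[ℝ] TDual ρ => f t) (TDual.act_one ρ)
  mul_smul γ δ t := congrArg (fun f : TDual ρ →ₐ[ℝ] TDual ρ => f t) (TDual.act_mul ρ γ δ)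
  smul_zero γ := map_zero (TDual.act ρ γ)
  smul_add γ := map_add (TDual.act ρ γ)
  smul_one γ := map_one (TDual.act ρ γ)
  smul_mul γ := map_mul (TDual.act ρ γ)

instance : MulSemiringAction Γ (SDual ρ) where
  smul γ t := SDual.act ρ γ t
  one_smul t := congrArg (fun f : SDual ρ →ₐ[ℝ] SDual ρ => f t) (SDual.act_one ρ)
  mul_smul γ δ t := congrArg (fun f : SDual ρ →ₐ[ℝ] SDual ρ => f t) (SDual.act_mul ρ γ δ)
  smul_zero γ := map_zero (SDual.act ρ γ)
  smul_add γ := map_add (SDual.act ρ γ)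
  smul_one γ := map_one (SDual.act ρ γ)
  smul_mul γ := map_mul (SDual.act ρ γ)

instance : SMulCommClass Γ ℝ (TDual ρ) := ⟨fun γ r t => map_smul (TDual.act ρ γ) r t⟩
instance : SMulCommClass Γ ℝ (SDual ρ) := ⟨fun γ r t => map_smul (SDual.act ρ γ) r t⟩

/-- `T(V*) ⋊ Γ`. -/
abbrev TCross : Type _ := SkewMonoidAlgebra (TDual ρ) Γ

/-- `S(V*) ⋊ Γ`. -/
abbrev SCross : Type _ := SkewMonoidAlgebra (SDual ρ) Γ

/-- The canonical map `T(V*) ⋊ Γ → S(V*) ⋊ Γ`. -/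
def TCross.toSCross (f : TCross ρ) : SCross ρ :=
  ⟨f.coeff.mapRange (TDual.toSDual ρ) (map_zero _)⟩

/-- The elements of `T(V*)` that are combinations of words of length at most `n`. -/
def TDual.wordsLE (n : ℕ) : Submodule ℝ (TDual ρ) := (1 ⊔ LinearMap.range (TDual.ι ρ)) ^ n

lemma TDual.wordsLE_mono : Monotone (TDual.wordsLE ρ) :=
  fun _ _ h => pow_le_pow_right' (le_sup_left : (1 : Submodule ℝ (TDual ρ)) ≤ _) h

lemma TDual.smul_mem_wordsLE (γ : Γ) {n : ℕ} {t : TDual ρ} (ht : t ∈ TDual.wordsLE ρ n) :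
    γ • t ∈ TDual.wordsLE ρ n := by
  have h1 : (1 ⊔ LinearMap.range (TDual.ι ρ) : Submodule ℝ (TDual ρ)).map
      (TDual.act ρ γ).toLinearMap ≤ 1 ⊔ LinearMap.range (TDual.ι ρ) := by
    rw [Submodule.map_sup, Submodule.map_one]
    refine sup_le_sup_left ?_ _
    rintro _ ⟨_, ⟨x, rfl⟩, rfl⟩
    exact ⟨ρ.dual γ x, (TDual.act_ι ρ γ x).symm⟩
  have h2 : (TDual.wordsLE ρ n).map (TDual.act ρ γ).toLinearMap ≤ TDual.wordsLE ρ n := by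
    unfold TDual.wordsLE
    rw [Submodule.map_pow]
    exact pow_le_pow_left' h1 n
  exact h2 ⟨t, ht, rfl⟩

/-- The elements of `T(V*) ⋊ Γ` that are combinations of `x₁ ⊗ ⋯ ⊗ xᵢ γ` with `i ≤ n`. -/
def TCross.wordsLE (n : ℕ) : Submodule ℝ (TCross ρ) where
  carrier := {f | ∀ γ, f.coeff γ ∈ TDual.wordsLE ρ n}
  zero_mem' := fun γ => by
    rw [SkewMonoidAlgebra.coeff_zero]; exact Submodule.zero_mem _
  add_mem' := fun {f g} hf hg γ => by
    rw [SkewMonoidAlgebra.coeff_add]; exact Submodule.add_mem _ (hf γ) (hg γ)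
  smul_mem' := fun r f hf γ => by
    rw [SkewMonoidAlgebra.coeff_smul]; exact Submodule.smul_mem _ r (hf γ)

lemma TCross.single_mem_wordsLE {n : ℕ} {t : TDual ρ} (ht : t ∈ TDual.wordsLE ρ n) (γ : Γ) :
    SkewMonoidAlgebra.single γ t ∈ TCross.wordsLE ρ n := by
  classical
  intro δ
  rw [SkewMonoidAlgebra.coeff_single_apply]
  split_ifs
  · exact ht
  · exact Submodule.zero_mem _

lemma TCross.mul_mem_wordsLE {m n : ℕ} {f g : TCross ρ} (hf : f ∈ TCross.wordsLE ρ m)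
    (hg : g ∈ TCross.wordsLE ρ n) : f * g ∈ TCross.wordsLE ρ (m + n) := by
  rw [SkewMonoidAlgebra.mul_def, SkewMonoidAlgebra.sum_def, Finsupp.sum]
  refine Submodule.sum_mem _ fun γ _ => ?_
  rw [SkewMonoidAlgebra.sum_def, Finsupp.sum]
  refine Submodule.sum_mem _ fun δ _ => TCross.single_mem_wordsLE ρ ?_ _
  unfold TDual.wordsLE
  rw [pow_add]
  exact Submodule.mul_mem_mul (hf γ) (TDual.smul_mem_wordsLE ρ γ (hg δ))

/-- `x ∈ V*` as an element of `T(V*) ⋊ Γ`. -/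
def TCross.vec (x : Module.Dual ℝ V) : TCross ρ := SkewMonoidAlgebra.single 1 (TDual.ι ρ x)

/-- `γ ∈ Γ` as an element of `T(V*) ⋊ Γ`. -/
def TCross.grp (γ : Γ) : TCross ρ := SkewMonoidAlgebra.single γ 1

/-- `x ∈ V*` as an element of `S(V*) ⋊ Γ`. -/
def SCross.vec (x : Module.Dual ℝ V) : SCross ρ := SkewMonoidAlgebra.single 1 (SDual.ι ρ x)

/-- `γ ∈ Γ` as an element of `S(V*) ⋊ Γ`. -/
def SCross.grp (γ : Γ) : SCross ρ := SkewMonoidAlgebra.single γ 1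

lemma TCross.vec_mem (x : Module.Dual ℝ V) : TCross.vec ρ x ∈ TCross.wordsLE ρ 1 :=
  TCross.single_mem_wordsLE ρ (by
    unfold TDual.wordsLE
    rw [pow_one]
    exact Submodule.mem_sup_right ⟨x, rfl⟩) 1

lemma TCross.grp_mem (γ : Γ) : TCross.grp ρ γ ∈ TCross.wordsLE ρ 0 :=
  TCross.single_mem_wordsLE ρ (by
    unfold TDual.wordsLE
    rw [pow_zero]
    exact Submodule.one_le.mp le_rfl) γ

/-! ### Quotients of `(T(V*) ⋊ Γ)[[ħ]]` and their filtration by length of words -/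

variable {ρ}

/-- The quotient of `(T(V*) ⋊ Γ)[[ħ]]` by a two-sided ideal `J`. -/
abbrev QuotAlg (J : TwoSidedIdeal (TCross ρ)⟦X⟧) : Type _ := J.ringCon.Quotient

/-- The quotient map, as a homomorphism of `ℝ[[ħ]]`-algebras. -/
def QuotAlg.mk (J : TwoSidedIdeal (TCross ρ)⟦X⟧) : (TCross ρ)⟦X⟧ →ₐ[ℝ⟦X⟧] QuotAlg J :=
  RingCon.mkₐ ℝ⟦X⟧ J.ringCon

/-- The power series whose coefficients are combinations of words of length at most `n`. -/
def seriesWordsLE (ρ : Representation ℝ Γ V) (n : ℕ) : Submodule ℝ⟦X⟧ (TCross ρ)⟦X⟧ where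
  carrier := {f | ∀ i, PowerSeries.coeff i f ∈ TCross.wordsLE ρ n}
  zero_mem' := fun i => by rw [map_zero]; exact Submodule.zero_mem _
  add_mem' := fun {f g} hf hg i => by rw [map_add]; exact Submodule.add_mem _ (hf i) (hg i)
  smul_mem' := fun r f hf i => by
    rw [Algebra.smul_def]
    change PowerSeries.coeff i (PowerSeries.map (algebraMap ℝ (TCross ρ)) r * f) ∈ _
    rw [PowerSeries.coeff_mul]
    refine Submodule.sum_mem _ fun p _ => ?_
    rw [PowerSeries.coeff_map, ← Algebra.smul_def]
    exact Submodule.smul_mem _ _ (hf _)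

lemma C_mem_seriesWordsLE {n : ℕ} {t : TCross ρ} (ht : t ∈ TCross.wordsLE ρ n) :
    PowerSeries.C t ∈ seriesWordsLE ρ n := by
  classical
  intro i
  rw [PowerSeries.coeff_C]
  split_ifs
  · exact ht
  · exact Submodule.zero_mem _

/-- The filtration of a quotient of `(T(V*) ⋊ Γ)[[ħ]]` by length of words. -/
def wordFiltration (J : TwoSidedIdeal (TCross ρ)⟦X⟧) : AlgFiltration ℝ⟦X⟧ (QuotAlg J) where
  deg n := (seriesWordsLE ρ n).map (QuotAlg.mk J).toLinearMap
  mono := fun _ _ h => Submodule.map_mono fun _ hf i γ => TDual.wordsLE_mono ρ h (hf i γ)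
  one_mem := ⟨1, C_mem_seriesWordsLE (TCross.grp_mem ρ 1), map_one (QuotAlg.mk J)⟩
  mul_mem := by
    rintro m n _ _ ⟨f, hf, rfl⟩ ⟨g, hg, rfl⟩
    refine ⟨f * g, fun i => ?_, map_mul (QuotAlg.mk J) f g⟩
    rw [PowerSeries.coeff_mul]
    exact Submodule.sum_mem _ fun p _ => TCross.mul_mem_wordsLE ρ (hf _) (hg _)

/-- The symbol in `Gr₁` of the generator `x ∈ V*` of a quotient of `(T(V*) ⋊ Γ)[[ħ]]`. -/
def symbolVec (J : TwoSidedIdeal (TCross ρ)⟦X⟧) (x : Module.Dual ℝ V) : (wordFiltration J).Gr :=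
  (wordFiltration J).symbol 1 ⟨QuotAlg.mk J (PowerSeries.C (TCross.vec ρ x)),
    ⟨_, C_mem_seriesWordsLE (TCross.vec_mem ρ x), rfl⟩⟩

/-- The symbol in `Gr₀` of the generator `γ ∈ Γ` of a quotient of `(T(V*) ⋊ Γ)[[ħ]]`. -/
def symbolGrp (J : TwoSidedIdeal (TCross ρ)⟦X⟧) (γ : Γ) : (wordFiltration J).Gr :=
  (wordFiltration J).symbol 0 ⟨QuotAlg.mk J (PowerSeries.C (TCross.grp ρ γ)),
    ⟨_, C_mem_seriesWordsLE (TCross.grp_mem ρ γ), rfl⟩⟩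

/-- The PBW property: the associated graded algebra for the filtration by length of words is
`S(V*) ⋊ Γ` with coefficients in `ℝ[[ħ]]`, compatibly with the generators. -/
def HasPBW (J : TwoSidedIdeal (TCross ρ)⟦X⟧) : Prop :=
  ∃ e : (wordFiltration J).Gr ≃ₐ[ℝ⟦X⟧] ℝ⟦X⟧ ⊗[ℝ] SCross ρ,
    (∀ x : Module.Dual ℝ V, e (symbolVec J x) = 1 ⊗ₜ[ℝ] SCross.vec ρ x) ∧
    (∀ γ : Γ, e (symbolGrp J γ) = 1 ⊗ₜ[ℝ] SCross.grp ρ γ)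

/-- The closure of a two-sided ideal of `(T(V*) ⋊ Γ)[[ħ]]` in the `ħ`-adic topology. -/
def hbarClosure (J : TwoSidedIdeal (TCross ρ)⟦X⟧) : TwoSidedIdeal (TCross ρ)⟦X⟧ :=
  ⨅ n : ℕ, J ⊔ TwoSidedIdeal.span {(PowerSeries.X : (TCross ρ)⟦X⟧) ^ n}

/-! ### Constant Poisson structures -/

variable (ρ)

/-- `V^γ`. -/
def fixedSpace (γ : Γ) : Submodule ℝ V := LinearMap.ker (ρ γ - 1)

/-- `l(γ)`, the codimension of `V^γ` in `V`. -/
def len (γ : Γ) : ℕ := Module.finrank ℝ (V ⧸ fixedSpace ρ γ)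

/-- `N^γ`: the vectors of `V` on which all `γ`-fixed elements of `V*` vanish. It is the orthogonal
complement of `V^γ` for every `Γ`-invariant inner product. -/
def normalSpace (γ : Γ) : Submodule ℝ V := (LinearMap.ker (ρ.dual γ - 1)).dualCoannihilator

/-- A constant Poisson structure `π₀ + ∑_{l(γ) = 2} π_γ` on `S(V*) ⋊ Γ`, that is, an element of
`(⋀² V)^Γ ⊕ (⨁_{l(γ) = 2} ⋀² N^γ)^Γ`, with `Γ` permuting the components by conjugation.
(The Gerstenhaber bracket of any two such elements vanishes.) -/
structure ConstantPoisson where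
  /-- `π₀ ∈ ⋀² V` -/
  untwisted : ⋀[ℝ]^2 V
  /-- `π_γ ∈ ⋀² N^γ ⊆ ⋀² V` for `l(γ) = 2`, extended by zero to the other `γ` -/
  twisted : Γ → ⋀[ℝ]^2 V
  untwisted_invariant : ∀ g : Γ, exteriorPower.map 2 (ρ g) untwisted = untwisted
  twisted_mem : ∀ γ : Γ, len ρ γ = 2 →
    twisted γ ∈ LinearMap.range (exteriorPower.map 2 (normalSpace ρ γ).subtype)
  twisted_eq_zero : ∀ γ : Γ, len ρ γ ≠ 2 → twisted γ = 0
  twisted_invariant : ∀ g γ : Γ, exteriorPower.map 2 (ρ g) (twisted γ) = twisted (g * γ * g⁻¹)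

/-- The value `p(x, y)` of a bivector `p` on `x, y ∈ V*`;
`(v ∧ w)(x, y) = x(v) y(w) - x(w) y(v)`. -/
def bivectorEval (p : ⋀[ℝ]^2 V) (x y : Module.Dual ℝ V) : ℝ :=
  exteriorPower.pairingDual ℝ V 2 (exteriorPower.ιMulti ℝ 2 ![x, y]) p

namespace ConstantPoisson

variable {ρ} [Fintype Γ] (π : ConstantPoisson ρ)

/-- `π₀(x, y) + ∑_γ π_γ(x, y) γ`, as an element of `R ⋊ Γ` for a real algebra `R`. -/
def value (R : Type*) [Ring R] [Algebra ℝ R] (x y : Module.Dual ℝ V) : SkewMonoidAlgebra R Γ :=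
  SkewMonoidAlgebra.single 1 (algebraMap ℝ R (bivectorEval π.untwisted x y)) +
    ∑ γ : Γ, SkewMonoidAlgebra.single γ (algebraMap ℝ R (bivectorEval (π.twisted γ) x y))

/-- The two-sided ideal of `(T(V*) ⋊ Γ)[[ħ]]` generated by the elements
`x ⊗ y - y ⊗ x - ħ (π₀(x, y) + ∑_γ π_γ(x, y) γ)`. -/
def relIdeal : TwoSidedIdeal (TCross ρ)⟦X⟧ :=
  TwoSidedIdeal.span {f | ∃ x y : Module.Dual ℝ V,
    f = PowerSeries.C (TCross.vec ρ x * TCross.vec ρ y - TCross.vec ρ y * TCross.vec ρ x)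
      - PowerSeries.X * PowerSeries.C (π.value (TDual ρ) x y)}

/-- `H_π`, the quotient of `(T(V*) ⋊ Γ)[[ħ]]` by the (`ħ`-adically closed) two-sided ideal generated
by the relations. -/
abbrev H : Type _ := QuotAlg (hbarClosure π.relIdeal)

end ConstantPoisson

/-! ### Formal deformations and quantizations -/

/-- A formal deformation of an algebra `A`: a unital associative `ℝ[[ħ]]`-bilinear product
`a ⋆ b = ab + ħ B₁(a, b) + ħ² B₂(a, b) + ⋯` on `A[[ħ]]`, given by its coefficients. -/
structure FormalDeformation (A : Type*) [Ring A] [Algebra ℝ A] where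
  B : ℕ → A →ₗ[ℝ] A →ₗ[ℝ] A
  B_zero : ∀ a b : A, B 0 a b = a * b
  one_left : ∀ n a, B (n + 1) 1 a = 0
  one_right : ∀ n a, B (n + 1) a 1 = 0
  assoc : ∀ n a b c, ∑ p ∈ Finset.HasAntidiagonal.antidiagonal n, B p.1 (B p.2 a b) c =
    ∑ p ∈ Finset.HasAntidiagonal.antidiagonal n, B p.1 a (B p.2 b c)

/-- The product `f ⋆ g = ∑ ħ^(i+j+k) B_i(f_j, g_k)` on `A[[ħ]]`. -/
def FormalDeformation.star {A : Type*} [Ring A] [Algebra ℝ A] (D : FormalDeformation A)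
    (f g : A⟦X⟧) : A⟦X⟧ :=
  PowerSeries.mk fun n => ∑ p ∈ Finset.HasAntidiagonal.antidiagonal n, ∑ q ∈ Finset.HasAntidiagonal.antidiagonal p.2,
    D.B p.1 (PowerSeries.coeff q.1 f) (PowerSeries.coeff q.2 g)

namespace ConstantPoisson

variable {ρ} [Fintype Γ] (π : ConstantPoisson ρ)

/-- The bilinear map `b` represents the class of `π` in `H²(S(V*) ⋊ Γ, S(V*) ⋊ Γ)`: after
subtracting a Hochschild coboundary it is a cochain relative to `ℝΓ` whose restriction to the Koszul
complex, `x ∧ y ↦ c(x, y) - c(y, x)`, is `π`. -/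
def IsClassOf (b : SCross ρ →ₗ[ℝ] SCross ρ →ₗ[ℝ] SCross ρ) : Prop :=
  ∃ (φ : SCross ρ →ₗ[ℝ] SCross ρ) (c : SCross ρ →ₗ[ℝ] SCross ρ →ₗ[ℝ] SCross ρ),
    (∀ a a', c a a' = b a a' - (a * φ a' - φ (a * a') + φ a * a')) ∧
    (∀ γ a a', c (SCross.grp ρ γ * a) a' = SCross.grp ρ γ * c a a') ∧
    (∀ γ a a', c (a * SCross.grp ρ γ) a' = c a (SCross.grp ρ γ * a')) ∧
    (∀ γ a a', c a (a' * SCross.grp ρ γ) = c a a' * SCross.grp ρ γ) ∧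
    ∀ x y : Module.Dual ℝ V, c (SCross.vec ρ x) (SCross.vec ρ y)
      - c (SCross.vec ρ y) (SCross.vec ρ x) = π.value (SDual ρ) x y

/-- A formal deformation of `S(V*) ⋊ Γ` quantizes `π` if its infinitesimal has class `π`. -/
def IsQuantizedBy (D : FormalDeformation (SCross ρ)) : Prop := π.IsClassOf (D.B 1)

/-- `π` is quantizable if some formal deformation of `S(V*) ⋊ Γ` quantizes it. -/
def IsQuantizable : Prop := ∃ D : FormalDeformation (SCross ρ), π.IsQuantizedBy D

/-- `H_π` is a deformation quantization of `S(V*) ⋊ Γ` with respect to `π`: as an algebra over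
`ℝ[[ħ]]` it is `(S(V*) ⋊ Γ)[[ħ]]` with a star product that quantizes `π`, and modulo `ħ` the
identification is the canonical one. -/
def HIsQuantization : Prop :=
  ∃ D : FormalDeformation (SCross ρ), π.IsQuantizedBy D ∧
    ∃ Φ : (SCross ρ)⟦X⟧ ≃ₗ[ℝ⟦X⟧] π.H,
      (∀ f g, Φ (D.star f g) = Φ f * Φ g) ∧
      ∀ t : TCross ρ, PowerSeries.constantCoeff
        (Φ.symm (QuotAlg.mk (hbarClosure π.relIdeal) (PowerSeries.C t))) = TCross.toSCross ρ t

end ConstantPoisson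

end OrbifoldPBW

end

set_option linter.unusedSectionVars false

noncomputable section

namespace OrbifoldPBW

/-! ### Independence of the total correction from the order of sorting. -/

section

/-! ### Sorting words with corrections -/

section Sorting

variable {ι M : Type*} [LinearOrder ι] [AddCommGroup M]

/-! The relations `x y - y x = ħ π(x, y)` form a rewriting system on words, as for an enveloping
algebra, and everything follows once rewriting is known to be confluent. The obstruction is a Jacobi
identity in `T(V*) ⋊ Γ`: the commutators of `π(x, y)` with `z` must have cyclic sum zero. The
untwisted part is central, and the component of the commutator at `γ` is `π_γ(x, y) (γ z - z) γ`.
The cyclic sum of these is alternating in `x, y, z` and depends only on their classes modulo the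
`γ`-fixed vectors, a space of dimension at most `l(γ) = 2`, so it vanishes (`twisted_jacobi`,
`valueLin_jacobi`).

Confluence is used in linear form. Fix a section `s` of `T(V*) ⋊ Γ → S(V*) ⋊ Γ` that commutes with
`Γ` on both sides. A normal form is a series `N = ∑ ħⁿ Nₙ` with `N₀` the projection, `Nₙ₊₁ ∘ s = 0`,
and `Nₙ₊₁` of `f (x y - y x) g` equal to `Nₙ` of `f π(x, y) g`. On a word, `Nₙ₊₁` is, up to a term
restoring `Nₙ₊₁ ∘ s = 0`, the sum of the corrections `Nₙ(u π(a, b) v)` met while the word is sorted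
by insertion. By `IsSwapCorrection.sort_swap` this sum changes by the right correction under every
adjacent swap, provided that disjoint swaps are compatible and that overlapping swaps of three
letters satisfy the Jacobi identity; `NormalForm.isSwapCorrection` checks both.

Given `N`, the star product is `Bₙ(a, b) = Nₙ(s a · s b)`: both bracketings of `a ⋆ b ⋆ c` equal
`N(s a · s b · s c)` (`sum_toLin_mul`, `sum_mul_toLin`). Since `N` kills the closure of `I_π`
(`series_eq_zero_of_mem`) and `f - s(N f)` always lies in it (`defect_mem_hbarClosure`), `N`
identifies `H_π` with this deformation.

For PBW, the symbols of the generators satisfy the relations of `S(V*) ⋊ Γ`, which gives a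
surjection from `ℝ[[ħ]] ⊗ (S(V*) ⋊ Γ)` onto the associated graded algebra. Each power of `ħ` in `N`
costs two letters, so the top homogeneous component of `N` depends only on the symbol and detects
it; this gives injectivity. The argument applies to every ideal that contains `I_π` and is killed by
`N`, hence to `I_π` and to its closure alike. -/

/-- The sum of the corrections `E` met when `a` is inserted into `m` behind the prefix `p`. -/
def insertCorrection (E : List ι → ι → ι → List ι → M) : List ι → ι → List ι → M
  | _, _, [] => 0
  | p, a, b :: m => if a ≤ b then 0 else E p a b m + insertCorrection E (p ++ [b]) a m

/-- The sum of the corrections `E` met when `w` is sorted by insertion behind the prefix `p`. -/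
def sortCorrection (E : List ι → ι → ι → List ι → M) : List ι → List ι → M
  | _, [] => 0
  | p, a :: w => sortCorrection E (p ++ [a]) w +
      insertCorrection E p a (w.insertionSort (· ≤ ·))

/-- The compatibilities that make a system of corrections `E u a b v`, for replacing the word
`u a b v` by `u b a v`, independent of the way in which words are sorted. -/
structure IsSwapCorrection (E : List ι → ι → ι → List ι → M) : Prop where
  self : ∀ u a v, E u a a v = 0
  antisymm : ∀ u a b v, E u a b v = - E u b a v
  disjoint : ∀ u a b v c d w,
    E u a b (v ++ c :: d :: w) - E u a b (v ++ d :: c :: w) =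
      E (u ++ a :: b :: v) c d w - E (u ++ b :: a :: v) c d w
  overlap : ∀ u a b c v,
    E u a b (c :: v) + E (u ++ [b]) a c v + E u b c (a :: v) =
      E (u ++ [a]) b c v + E u a c (b :: v) + E (u ++ [c]) a b v

variable {E : List ι → ι → ι → List ι → M}

lemma insertionSort_cons_cons_comm (a b : ι) (v : List ι) :
    (a :: b :: v).insertionSort (· ≤ ·) = (b :: a :: v).insertionSort (· ≤ ·) :=
  (((List.perm_insertionSort _ _).trans (List.Perm.swap b a v)).trans
    (List.perm_insertionSort _ _).symm).eq_of_pairwise' (List.pairwise_insertionSort _ _)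
      (List.pairwise_insertionSort _ _)

lemma insertionSort_append_cons_cons_comm (u : List ι) (a b : ι) (v : List ι) :
    (u ++ a :: b :: v).insertionSort (· ≤ ·) = (u ++ b :: a :: v).insertionSort (· ≤ ·) := by
  induction u with
  | nil => exact insertionSort_cons_cons_comm a b v
  | cons c u ih =>
    rw [List.cons_append, List.cons_append, List.insertionSort_cons, List.insertionSort_cons, ih]

/-- By `disjoint`, each step of the insertion contributes the change of `E p a b` as `c` moves past
one letter; these changes telescope. -/
lemma IsSwapCorrection.insert_sub (h : IsSwapCorrection E) (p : List ι) (a b : ι) (c : ι)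
    (m : List ι) : ∀ q : List ι,
    insertCorrection E (p ++ a :: b :: q) c m - insertCorrection E (p ++ b :: a :: q) c m =
      E p a b (q ++ c :: m) - E p a b (q ++ m.orderedInsert (· ≤ ·) c) := by
  induction m with
  | nil => intro q; simp [insertCorrection]
  | cons d m ih =>
    intro q
    rw [insertCorrection, insertCorrection, List.orderedInsert_cons]
    split_ifs with hcd
    · simp
    · have h1 := ih (q ++ [d])
      have h2 := h.disjoint p a b q c d m
      simp only [List.append_assoc, List.cons_append, List.nil_append] at h1 ⊢
      rw [add_sub_add_comm, h1, ← h2]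
      abel

lemma IsSwapCorrection.sort_sub (h : IsSwapCorrection E) (p : List ι) (a b : ι)
    (v : List ι) : ∀ q : List ι,
    sortCorrection E (p ++ a :: b :: q) v - sortCorrection E (p ++ b :: a :: q) v =
      E p a b (q ++ v) - E p a b (q ++ v.insertionSort (· ≤ ·)) := by
  induction v with
  | nil => intro q; simp [sortCorrection]
  | cons c v ih =>
    intro q
    have h1 := ih (q ++ [c])
    have h2 := h.insert_sub p a b c (v.insertionSort (· ≤ ·)) q
    simp only [List.append_assoc, List.cons_append, List.nil_append] at h1
    simp only [sortCorrection, List.append_assoc, List.cons_append,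
      List.insertionSort_cons]
    rw [add_sub_add_comm, h1, h2]
    abel

/-- Swapping `a` with `b` and then inserting both letters amounts to inserting them in the other
order. The list `m` need not be sorted. If one of the letters stops at the head, only their mutual
comparison is left; if both pass the head, this is the hexagon for three letters. -/
lemma IsSwapCorrection.insert_insert (h : IsSwapCorrection E) (a b : ι) (m : List ι) :
    ∀ p : List ι,
    (insertCorrection E (p ++ [a]) b m +
        insertCorrection E p a (m.orderedInsert (· ≤ ·) b)) -
      (insertCorrection E (p ++ [b]) a m +
        insertCorrection E p b (m.orderedInsert (· ≤ ·) a)) = E p a b m := by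
  induction m with
  | nil =>
    intro p
    simp only [insertCorrection, List.orderedInsert_nil]
    rcases lt_trichotomy a b with hab | rfl | hab
    · rw [if_pos hab.le, if_neg hab.not_ge, h.antisymm p a b]; abel
    · simp [h.self]
    · rw [if_neg hab.not_ge, if_pos hab.le]; abel
  | cons c m ih =>
    intro p
    by_cases hac : a ≤ c <;> by_cases hbc : b ≤ c
    · simp only [insertCorrection, List.orderedInsert_cons, if_pos hac, if_pos hbc]
      rcases lt_trichotomy a b with hab | rfl | hab
      · rw [if_pos hab.le, if_neg hab.not_ge, h.antisymm p a b]; abel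
      · simp [h.self]
      · rw [if_neg hab.not_ge, if_pos hab.le]; abel
    · have hab : ¬ b ≤ a := fun hba => hbc (hba.trans hac)
      simp only [insertCorrection, List.orderedInsert_cons, if_pos hac, if_neg hbc, if_neg hab]
      rw [h.antisymm p a b]; abel
    · have hab : ¬ a ≤ b := fun hab => hac (hab.trans hbc)
      simp only [insertCorrection, List.orderedInsert_cons, if_neg hac, if_pos hbc, if_neg hab]
      abel
    · simp only [insertCorrection, List.orderedInsert_cons, if_neg hac, if_neg hbc]
      -- Both letters pass `c`: `insert_sub` with empty `q` brings the prefixes into a common order,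
      -- and `overlap` closes the hexagon formed by `a`, `b` and `c`.
      have h1 := ih (p ++ [c])
      have h2 := h.insert_sub p a c b m []
      have h3 := h.insert_sub p b c a m []
      have h4 := h.overlap p a b c m
      simp only [List.append_assoc, List.cons_append, List.nil_append] at h1 h2 h3 h4 ⊢
      linear_combination (norm := abel) h1 + h2 - h3 - h4

/-- Behind the swapped pair, `sort_sub` replaces `v` by its sorted form and `insert_insert` handles
the pair itself. Letters in front of the pair are inserted into the same sorted list on both sides,
so their contributions cancel. -/
theorem IsSwapCorrection.sort_swap (h : IsSwapCorrection E) (a b : ι) (v : List ι)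
    (u : List ι) : ∀ p : List ι,
    sortCorrection E p (u ++ a :: b :: v) - sortCorrection E p (u ++ b :: a :: v) =
      E (p ++ u) a b v := by
  induction u with
  | nil =>
    intro p
    have h1 := h.sort_sub p a b v []
    have h2 := h.insert_insert a b (v.insertionSort (· ≤ ·)) p
    simp only [List.nil_append] at h1
    simp only [sortCorrection, List.append_assoc, List.cons_append, List.nil_append,
      List.append_nil, List.insertionSort_cons]
    linear_combination (norm := abel) h1 + h2
  | cons c u ih =>
    intro p
    simp only [List.cons_append, sortCorrection, insertionSort_append_cons_cons_comm u a b v]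
    rw [add_sub_add_right_eq_sub, ih]
    simp

end Sorting

end

/-! ### Crossed products, words in a basis, and their images in the symmetric algebra. -/

section

/-! ### Linear maps of crossed products -/

section CrossedProductMaps

variable {Γ R S : Type*} [Group Γ] [Ring R] [Algebra ℝ R] [MulSemiringAction Γ R]
  [SMulCommClass Γ ℝ R] [Ring S] [Algebra ℝ S] [MulSemiringAction Γ S] [SMulCommClass Γ ℝ S]

/-- The right `Γ`-linear extension of a linear map `R → S ⋊ Γ` to `R ⋊ Γ`. -/
def extendRight (c : R →ₗ[ℝ] SkewMonoidAlgebra S Γ) :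
    SkewMonoidAlgebra R Γ →ₗ[ℝ] SkewMonoidAlgebra S Γ :=
  (Finsupp.lsum ℝ fun γ =>
    LinearMap.mulRight ℝ (SkewMonoidAlgebra.single γ (1 : S)) ∘ₗ c) ∘ₗ
    (SkewMonoidAlgebra.coeffLinearEquiv (S := ℝ)).toLinearMap

lemma extendRight_single (c : R →ₗ[ℝ] SkewMonoidAlgebra S Γ) (γ : Γ) (r : R) :
    extendRight c (SkewMonoidAlgebra.single γ r) =
      c r * SkewMonoidAlgebra.single γ (1 : S) := by
  simp [extendRight, SkewMonoidAlgebra.coeffLinearEquiv]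

lemma single_mul_single_one (γ δ : Γ) (r : R) :
    SkewMonoidAlgebra.single γ r * SkewMonoidAlgebra.single δ 1 =
      SkewMonoidAlgebra.single (γ * δ) r := by
  simp

lemma extendRight_mul_single (c : R →ₗ[ℝ] SkewMonoidAlgebra S Γ) (f : SkewMonoidAlgebra R Γ)
    (γ : Γ) : extendRight c (f * SkewMonoidAlgebra.single γ 1) =
      extendRight c f * SkewMonoidAlgebra.single γ 1 := by
  induction f using SkewMonoidAlgebra.induction_on with
  | zero => simp
  | single δ r =>
    rw [single_mul_single_one, extendRight_single, extendRight_single, mul_assoc,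
      single_mul_single_one]
  | add f g hf hg => rw [add_mul, map_add, map_add, add_mul, hf, hg]

/-- The inclusion `R → R ⋊ Γ`, as a linear map. -/
def inclCross : R →ₗ[ℝ] SkewMonoidAlgebra R Γ where
  toFun := SkewMonoidAlgebra.single 1
  map_add' := SkewMonoidAlgebra.single_add 1
  map_smul' c r := (SkewMonoidAlgebra.smul_single c 1 r).symm

lemma single_one_mul (r s : R) : SkewMonoidAlgebra.single (1 : Γ) (r * s) =
    SkewMonoidAlgebra.single (1 : Γ) r * SkewMonoidAlgebra.single (1 : Γ) s := by
  simp

lemma single_eq_mul (γ : Γ) (r : R) : SkewMonoidAlgebra.single γ r =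
    SkewMonoidAlgebra.single (1 : Γ) r * SkewMonoidAlgebra.single γ (1 : R) := by
  simp

lemma crossAlgebraMap_apply (r : ℝ) : algebraMap ℝ (SkewMonoidAlgebra R Γ) r =
    SkewMonoidAlgebra.single 1 (algebraMap ℝ R r) := by
  rw [Algebra.algebraMap_eq_smul_one, Algebra.algebraMap_eq_smul_one,
    SkewMonoidAlgebra.one_def, SkewMonoidAlgebra.smul_single]

end CrossedProductMaps

variable {Γ V : Type*} [Group Γ] [AddCommGroup V] [Module ℝ V] (ρ : Representation ℝ Γ V)

lemma TDual.smul_ι (γ : Γ) (x : Module.Dual ℝ V) : γ • TDual.ι ρ x = TDual.ι ρ (ρ.dual γ x) :=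
  TDual.act_ι ρ γ x

lemma SDual.smul_ι (γ : Γ) (x : Module.Dual ℝ V) : γ • SDual.ι ρ x = SDual.ι ρ (ρ.dual γ x) :=
  SDual.act_ι ρ γ x

lemma TDual.toSDual_ι (x : Module.Dual ℝ V) : TDual.toSDual ρ (TDual.ι ρ x) = SDual.ι ρ x :=
  rfl

lemma TDual.toSDual_smul (γ : Γ) (t : TDual ρ) :
    TDual.toSDual ρ (γ • t) = γ • TDual.toSDual ρ t := by
  have : (TDual.toSDual ρ).comp (TDual.act ρ γ) = (SDual.act ρ γ).comp (TDual.toSDual ρ) :=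
    TensorAlgebra.hom_ext (LinearMap.ext fun x => by
      change TDual.toSDual ρ (TDual.act ρ γ (TDual.ι ρ x)) =
        SDual.act ρ γ (TDual.toSDual ρ (TDual.ι ρ x))
      rw [TDual.act_ι, TDual.toSDual_ι, TDual.toSDual_ι, SDual.act_ι])
  exact DFunLike.congr_fun this t

/-- The canonical map `T(V*) ⋊ Γ → S(V*) ⋊ Γ`, as a linear map. -/
def TCross.proj : TCross ρ →ₗ[ℝ] SCross ρ :=
  extendRight (inclCross ∘ₗ (TDual.toSDual ρ).toLinearMap)

lemma TCross.proj_single (γ : Γ) (t : TDual ρ) :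
    TCross.proj ρ (SkewMonoidAlgebra.single γ t) =
      SkewMonoidAlgebra.single γ (TDual.toSDual ρ t) := by
  rw [TCross.proj, extendRight_single]
  change SkewMonoidAlgebra.single 1 (TDual.toSDual ρ t) * _ = _
  rw [single_mul_single_one, one_mul]

lemma TCross.proj_eq_toSCross (t : TCross ρ) : TCross.proj ρ t = TCross.toSCross ρ t := by
  induction t using SkewMonoidAlgebra.induction_on with
  | zero =>
    rw [map_zero]
    exact SkewMonoidAlgebra.ext fun γ => by simp [TCross.toSCross]
  | single γ r =>
    rw [TCross.proj_single]
    exact SkewMonoidAlgebra.coeff_injective (by simp [TCross.toSCross])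
  | add f g hf hg =>
    rw [map_add, hf, hg]
    exact SkewMonoidAlgebra.ext fun γ => by simp [TCross.toSCross]

lemma TCross.proj_mul (f g : TCross ρ) :
    TCross.proj ρ (f * g) = TCross.proj ρ f * TCross.proj ρ g := by
  induction f using SkewMonoidAlgebra.induction_on with
  | zero => simp
  | add f f' hf hf' => rw [add_mul, map_add, map_add, add_mul, hf, hf']
  | single γ r =>
    induction g using SkewMonoidAlgebra.induction_on with
    | zero => simp
    | add g g' hg hg' => rw [mul_add, map_add, map_add, mul_add, hg, hg']
    | single δ s =>
      rw [SkewMonoidAlgebra.single_mul_single, TCross.proj_single, TCross.proj_single,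
        TCross.proj_single, SkewMonoidAlgebra.single_mul_single, map_mul, TDual.toSDual_smul]

lemma TCross.proj_vec (x : Module.Dual ℝ V) : TCross.proj ρ (TCross.vec ρ x) = SCross.vec ρ x := by
  rw [TCross.vec, TCross.proj_single, TDual.toSDual_ι, SCross.vec]

lemma TCross.proj_grp (γ : Γ) : TCross.proj ρ (TCross.grp ρ γ) = SCross.grp ρ γ := by
  rw [TCross.grp, TCross.proj_single, map_one, SCross.grp]

lemma TCross.proj_one : TCross.proj ρ 1 = 1 := TCross.proj_grp ρ 1

lemma TDual.toSDual_surjective : Function.Surjective (TDual.toSDual ρ) :=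
  SymmetricAlgebra.algHom_surjective ℝ (Module.Dual ℝ V)

lemma TCross.proj_surjective : Function.Surjective (TCross.proj ρ) := by
  intro a
  induction a using SkewMonoidAlgebra.induction_on with
  | zero => exact ⟨0, map_zero _⟩
  | single γ r =>
    obtain ⟨t, rfl⟩ := TDual.toSDual_surjective ρ r
    exact ⟨_, TCross.proj_single ρ γ t⟩
  | add f g hf hg =>
    obtain ⟨t, rfl⟩ := hf
    obtain ⟨u, rfl⟩ := hg
    exact ⟨t + u, map_add _ _ _⟩

lemma TCross.grp_mul_vec (γ : Γ) (x : Module.Dual ℝ V) :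
    TCross.grp ρ γ * TCross.vec ρ x = TCross.vec ρ (ρ.dual γ x) * TCross.grp ρ γ := by
  simp [TCross.grp, TCross.vec, TDual.smul_ι]

lemma SCross.grp_mul_vec (γ : Γ) (x : Module.Dual ℝ V) :
    SCross.grp ρ γ * SCross.vec ρ x = SCross.vec ρ (ρ.dual γ x) * SCross.grp ρ γ := by
  simp [SCross.grp, SCross.vec, SDual.smul_ι]

lemma TCross.grp_mul_grp (γ δ : Γ) :
    TCross.grp ρ γ * TCross.grp ρ δ = TCross.grp ρ (γ * δ) := single_mul_single_one γ δ 1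

lemma SCross.grp_mul_grp (γ δ : Γ) :
    SCross.grp ρ γ * SCross.grp ρ δ = SCross.grp ρ (γ * δ) := single_mul_single_one γ δ 1

lemma TCross.grp_one : TCross.grp ρ 1 = 1 := rfl

lemma SCross.vec_mul_comm (x y : Module.Dual ℝ V) :
    SCross.vec ρ x * SCross.vec ρ y = SCross.vec ρ y * SCross.vec ρ x := by
  rw [SCross.vec, SCross.vec, ← single_one_mul, ← single_one_mul, mul_comm]

/-- The inclusion `V* → T(V*) ⋊ Γ`. -/
def TCross.vecLin : Module.Dual ℝ V →ₗ[ℝ] TCross ρ := inclCross ∘ₗ TDual.ι ρ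

/-- The commutator of `x, y ∈ V*` in `T(V*) ⋊ Γ`, as a bilinear map. -/
def TCross.comm : Module.Dual ℝ V →ₗ[ℝ] Module.Dual ℝ V →ₗ[ℝ] TCross ρ :=
  (LinearMap.mul ℝ (TCross ρ) - (LinearMap.mul ℝ (TCross ρ)).flip).compl₁₂
    (TCross.vecLin ρ) (TCross.vecLin ρ)

lemma TCross.comm_apply (x y : Module.Dual ℝ V) : TCross.comm ρ x y =
    TCross.vec ρ x * TCross.vec ρ y - TCross.vec ρ y * TCross.vec ρ x := rfl

lemma TCross.proj_comm (x y : Module.Dual ℝ V) : TCross.proj ρ (TCross.comm ρ x y) = 0 := by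
  rw [TCross.comm_apply, map_sub, TCross.proj_mul, TCross.proj_mul, TCross.proj_vec,
    TCross.proj_vec, SCross.vec_mul_comm, sub_self]

lemma TCross.grp_mul_comm (γ : Γ) (x y : Module.Dual ℝ V) :
    TCross.grp ρ γ * TCross.comm ρ x y =
      TCross.comm ρ (ρ.dual γ x) (ρ.dual γ y) * TCross.grp ρ γ := by
  rw [TCross.comm_apply, TCross.comm_apply, mul_sub, sub_mul, ← mul_assoc, ← mul_assoc,
    TCross.grp_mul_vec, TCross.grp_mul_vec, mul_assoc, mul_assoc, TCross.grp_mul_vec,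
    TCross.grp_mul_vec, mul_assoc, mul_assoc]

/-! ### Words in a basis of `V*` -/

section Words

variable {ι : Type*} (b : Module.Basis ι ℝ (Module.Dual ℝ V))

/-- The word in `T(V*)` with the given letters from a basis of `V*`. -/
def TDual.word (w : List ι) : TDual ρ := (w.map fun i => TDual.ι ρ (b i)).prod

lemma TDual.word_append (v w : List ι) :
    TDual.word ρ b (v ++ w) = TDual.word ρ b v * TDual.word ρ b w := by
  simp [TDual.word]

lemma TDual.word_cons (i : ι) (w : List ι) :
    TDual.word ρ b (i :: w) = TDual.ι ρ (b i) * TDual.word ρ b w := by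
  simp [TDual.word]

lemma TDual.word_nil : TDual.word ρ b [] = 1 := rfl

/-- The words with letters in a basis of `V*` form a basis of `T(V*)`. -/
def TDual.wordBasis : Module.Basis (List ι) ℝ (TDual ρ) := b.tensorAlgebra

lemma TDual.wordBasis_apply (w : List ι) : TDual.wordBasis ρ b w = TDual.word ρ b w := by
  have h : FreeAlgebra.basisFreeMonoid ℝ ι (FreeMonoid.ofList w) =
      (w.map (FreeAlgebra.ι ℝ)).prod := by
    simp [FreeAlgebra.basisFreeMonoid, FreeAlgebra.equivMonoidAlgebraFreeMonoid,
      MonoidAlgebra.coeffLinearEquiv, FreeMonoid.lift_apply]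
  have h' : b.tensorAlgebra (FreeMonoid.ofList w) =
      (w.map fun i => TensorAlgebra.ι ℝ (b i)).prod := by
    rw [Module.Basis.tensorAlgebra, Module.Basis.map_apply, h, AlgEquiv.toLinearEquiv_apply,
      map_list_prod, List.map_map]
    congr 1
    exact List.map_congr_left fun i _ => TensorAlgebra.equivFreeAlgebra_symm_ι b i
  exact h'

lemma TDual.wordsLE_eq_span (n : ℕ) : TDual.wordsLE ρ n =
    Submodule.span ℝ (TDual.word ρ b '' {w | w.length ≤ n}) := by
  have h1 : (1 ⊔ LinearMap.range (TDual.ι ρ) : Submodule ℝ (TDual ρ)) =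
      Submodule.span ℝ (TDual.word ρ b '' {w | w.length ≤ 1}) := by
    apply le_antisymm
    · refine sup_le ?_ ?_
      · rw [Submodule.one_eq_span, Submodule.span_le, Set.singleton_subset_iff]
        exact Submodule.subset_span ⟨[], by simp, rfl⟩
      · rw [LinearMap.range_eq_map, ← b.span_eq, Submodule.map_span, Submodule.span_le]
        rintro _ ⟨_, ⟨i, rfl⟩, rfl⟩
        refine Submodule.subset_span ⟨[i], by simp, ?_⟩
        rw [TDual.word_cons, TDual.word_nil, mul_one]
    · rw [Submodule.span_le]
      rintro _ ⟨w, hw, rfl⟩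
      match w, hw with
      | [], _ => exact Submodule.mem_sup_left (Submodule.one_le.mp le_rfl)
      | [i], _ =>
        refine Submodule.mem_sup_right ⟨b i, ?_⟩
        rw [TDual.word_cons, TDual.word_nil, mul_one]
  unfold TDual.wordsLE
  rw [h1]
  induction n with
  | zero =>
    rw [pow_zero, Submodule.one_eq_span]
    congr 1
    ext t
    simp [TDual.word_nil]
  | succ n ih =>
    rw [pow_succ, ih, Submodule.span_mul_span]
    congr 1
    ext t
    constructor
    · rintro ⟨_, ⟨v, hv, rfl⟩, _, ⟨w, hw, rfl⟩, rfl⟩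
      refine ⟨v ++ w, ?_, TDual.word_append ρ b v w⟩
      simp only [Set.mem_ofPred_eq, List.length_append] at *
      omega
    · rintro ⟨w, hw, rfl⟩
      refine ⟨_, ⟨w.take n, ?_, rfl⟩, _, ⟨w.drop n, ?_, rfl⟩, ?_⟩
      · simp
      · simp only [Set.mem_ofPred_eq, List.length_drop] at *
        omega
      · dsimp only
        rw [← TDual.word_append, List.take_append_drop]

end Words

end

/-! ### Commutators filtered by length, and sections compatible with `Γ`. -/

section

variable {Γ V : Type*} [Group Γ] [AddCommGroup V] [Module ℝ V] (ρ : Representation ℝ Γ V)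

/-! ### The kernel of `T(V*) ⋊ Γ → S(V*) ⋊ Γ` -/

lemma TCross.wordsLE_mono : Monotone (TCross.wordsLE ρ) :=
  fun _ _ h _ hf γ => TDual.wordsLE_mono ρ h (hf γ)

lemma TCross.mem_sup_wordsLE (t : TCross ρ) {ι : Type*}
    (b : Module.Basis ι ℝ (Module.Dual ℝ V)) : ∃ n, t ∈ TCross.wordsLE ρ n := by
  have key : ∀ r : TDual ρ, ∃ n, r ∈ TDual.wordsLE ρ n := by
    intro r
    have hr : r ∈ Submodule.span ℝ (Set.range (TDual.wordBasis ρ b)) :=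
      (TDual.wordBasis ρ b).mem_span r
    induction hr using Submodule.span_induction with
    | mem x hx =>
      obtain ⟨w, rfl⟩ := hx
      refine ⟨w.length, ?_⟩
      rw [TDual.wordsLE_eq_span ρ b, TDual.wordBasis_apply]
      exact Submodule.subset_span ⟨w, (le_refl w.length : _), rfl⟩
    | zero => exact ⟨0, Submodule.zero_mem _⟩
    | add x y _ _ hx hy =>
      obtain ⟨m, hm⟩ := hx
      obtain ⟨n, hn⟩ := hy
      exact ⟨max m n, Submodule.add_mem _ (TDual.wordsLE_mono ρ (le_max_left _ _) hm)
        (TDual.wordsLE_mono ρ (le_max_right _ _) hn)⟩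
    | smul c x _ hx =>
      obtain ⟨m, hm⟩ := hx
      exact ⟨m, Submodule.smul_mem _ _ hm⟩
  induction t using SkewMonoidAlgebra.induction_on with
  | zero => exact ⟨0, Submodule.zero_mem _⟩
  | single γ r =>
    obtain ⟨n, hn⟩ := key r
    exact ⟨n, TCross.single_mem_wordsLE ρ hn γ⟩
  | add f g hf hg =>
    obtain ⟨m, hm⟩ := hf
    obtain ⟨n, hn⟩ := hg
    exact ⟨max m n, Submodule.add_mem _ (TCross.wordsLE_mono ρ (le_max_left _ _) hm)
      (TCross.wordsLE_mono ρ (le_max_right _ _) hn)⟩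

lemma TCross.wordsLE_le {ι : Type*} (b : Module.Basis ι ℝ (Module.Dual ℝ V)) {n : ℕ}
    {W : Submodule ℝ (TCross ρ)}
    (h : ∀ γ w, w.length ≤ n → SkewMonoidAlgebra.single γ (TDual.word ρ b w) ∈ W) :
    TCross.wordsLE ρ n ≤ W := by
  intro t ht
  rw [← SkewMonoidAlgebra.sum_single t, SkewMonoidAlgebra.sum_def, Finsupp.sum]
  refine Submodule.sum_mem _ fun γ _ => ?_
  have hγ := ht γ
  rw [TDual.wordsLE_eq_span ρ b] at hγ
  generalize t.coeff γ = r at hγ ⊢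
  induction hγ using Submodule.span_induction with
  | mem x hx =>
    obtain ⟨w, hw, rfl⟩ := hx
    exact h γ w hw
  | zero => rw [SkewMonoidAlgebra.single_zero]; exact Submodule.zero_mem _
  | add x y _ _ hx hy => rw [SkewMonoidAlgebra.single_add]; exact Submodule.add_mem _ hx hy
  | smul c x _ hx => rw [← SkewMonoidAlgebra.smul_single]; exact Submodule.smul_mem _ _ hx

/-- The span of the elements `f (x ⊗ y - y ⊗ x) g` of length at most `n`. -/
def TCross.commSpan (n : ℕ) : Submodule ℝ (TCross ρ) :=
  Submodule.span ℝ {t | ∃ (i j : ℕ) (f g : TCross ρ) (x y : Module.Dual ℝ V),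
    f ∈ TCross.wordsLE ρ i ∧ g ∈ TCross.wordsLE ρ j ∧ i + j + 2 ≤ n ∧
      t = f * TCross.comm ρ x y * g}

lemma TCross.commSpan_mono : Monotone (TCross.commSpan ρ) := fun _ _ h =>
  Submodule.span_mono fun _ ⟨i, j, f, g, x, y, hf, hg, hij, ht⟩ =>
    ⟨i, j, f, g, x, y, hf, hg, hij.trans h, ht⟩

lemma TCross.mul_mem_commSpan {m n : ℕ} {f t : TCross ρ} (hf : f ∈ TCross.wordsLE ρ m)
    (ht : t ∈ TCross.commSpan ρ n) : f * t ∈ TCross.commSpan ρ (m + n) := by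
  induction ht using Submodule.span_induction with
  | mem t ht =>
    obtain ⟨i, j, f', g, x, y, hf', hg, hij, rfl⟩ := ht
    refine Submodule.subset_span ⟨m + i, j, f * f', g, x, y,
      TCross.mul_mem_wordsLE ρ hf hf', hg, by omega, ?_⟩
    simp only [mul_assoc]
  | zero => rw [mul_zero]; exact Submodule.zero_mem _
  | add x y _ _ hx hy => rw [mul_add]; exact Submodule.add_mem _ hx hy
  | smul c x _ hx => rw [mul_smul_comm]; exact Submodule.smul_mem _ _ hx

lemma TCross.commSpan_mul_mem {m n : ℕ} {t g : TCross ρ} (ht : t ∈ TCross.commSpan ρ n)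
    (hg : g ∈ TCross.wordsLE ρ m) : t * g ∈ TCross.commSpan ρ (n + m) := by
  induction ht using Submodule.span_induction with
  | mem t ht =>
    obtain ⟨i, j, f, g', x, y, hf, hg', hij, rfl⟩ := ht
    refine Submodule.subset_span ⟨i, j + m, f, g' * g, x, y, hf,
      TCross.mul_mem_wordsLE ρ hg' hg, by omega, ?_⟩
    simp only [mul_assoc]
  | zero => rw [zero_mul]; exact Submodule.zero_mem _
  | add x y _ _ hx hy => rw [add_mul]; exact Submodule.add_mem _ hx hy
  | smul c x _ hx => rw [smul_mul_assoc]; exact Submodule.smul_mem _ _ hx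

lemma TCross.proj_eq_zero_of_mem_commSpan {n : ℕ} {t : TCross ρ}
    (ht : t ∈ TCross.commSpan ρ n) : TCross.proj ρ t = 0 := by
  induction ht using Submodule.span_induction with
  | mem t ht =>
    obtain ⟨i, j, f, g, x, y, -, -, -, rfl⟩ := ht
    rw [TCross.proj_mul, TCross.proj_mul, TCross.proj_comm, mul_zero, zero_mul]
  | zero => exact map_zero _
  | add x y _ _ hx hy => rw [map_add, hx, hy, add_zero]
  | smul c x _ hx => rw [map_smul, hx, smul_zero]

section Words

variable {ι : Type*} (b : Module.Basis ι ℝ (Module.Dual ℝ V))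

/-- The word in `T(V*) ⋊ Γ` with the given letters from a basis of `V*`. -/
def TCross.word (w : List ι) : TCross ρ := SkewMonoidAlgebra.single 1 (TDual.word ρ b w)

lemma TCross.word_append (v w : List ι) :
    TCross.word ρ b (v ++ w) = TCross.word ρ b v * TCross.word ρ b w := by
  rw [TCross.word, TCross.word, TCross.word, ← single_one_mul, TDual.word_append]

lemma TCross.word_cons (i : ι) (w : List ι) :
    TCross.word ρ b (i :: w) = TCross.vec ρ (b i) * TCross.word ρ b w := by
  rw [TCross.word, TCross.vec, TCross.word, ← single_one_mul, TDual.word_cons]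

lemma TCross.word_nil : TCross.word ρ b [] = 1 := rfl

lemma TCross.word_mul_grp (w : List ι) (γ : Γ) : TCross.word ρ b w * TCross.grp ρ γ =
    SkewMonoidAlgebra.single γ (TDual.word ρ b w) := by
  rw [TCross.word, TCross.grp, single_mul_single_one, one_mul]

lemma TCross.word_mem_wordsLE (w : List ι) : TCross.word ρ b w ∈ TCross.wordsLE ρ w.length := by
  refine TCross.single_mem_wordsLE ρ ?_ 1
  rw [TDual.wordsLE_eq_span ρ b]
  exact Submodule.subset_span ⟨w, (le_refl w.length : _), rfl⟩

/-- An adjacent transposition changes a word by a commutator placed between two words, and the total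
length is unchanged. The length bound is what later makes induction on length possible. -/
lemma TCross.word_sub_mem_commSpan {w w' : List ι} (h : w.Perm w') :
    TCross.word ρ b w - TCross.word ρ b w' ∈ TCross.commSpan ρ w.length := by
  induction h with
  | nil => simp
  | cons i h ih =>
    rw [TCross.word_cons, TCross.word_cons, ← mul_sub, List.length_cons, add_comm]
    exact TCross.mul_mem_commSpan ρ (TCross.vec_mem ρ _) ih
  | swap i j l =>
    refine Submodule.subset_span ⟨0, l.length, 1, TCross.word ρ b l, b j, b i,
      TCross.grp_mem ρ 1, TCross.word_mem_wordsLE ρ b l, by simp, ?_⟩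
    simp only [TCross.word_cons, TCross.comm_apply, one_mul, sub_mul, mul_assoc]
  | trans h₁ h₂ ih₁ ih₂ =>
    rw [h₁.length_eq] at ih₁ ⊢
    have := Submodule.add_mem _ ih₁ ih₂
    rwa [sub_add_sub_cancel] at this

variable [LinearOrder ι]

/-- The monomials in a basis of `V*` form a basis of `S(V*)`. -/
def SDual.monomialBasis : Module.Basis (ι →₀ ℕ) ℝ (SDual ρ) := b.symmetricAlgebra

/-- The linear section of `T(V*) → S(V*)` that sends monomials to sorted words. -/
def SDual.sortedSection : SDual ρ →ₗ[ℝ] TDual ρ :=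
  (SDual.monomialBasis ρ b).constr ℝ fun m => TDual.word ρ b ((Finsupp.toMultiset m).sort (· ≤ ·))

lemma TDual.toSDual_word (w : List ι) :
    TDual.toSDual ρ (TDual.word ρ b w) =
      SDual.monomialBasis ρ b (Multiset.toFinsupp (w : Multiset ι)) := by
  have h : SymmetricAlgebra.equivMvPolynomial b (TDual.toSDual ρ (TDual.word ρ b w)) =
      MvPolynomial.monomial (Multiset.toFinsupp (w : Multiset ι)) 1 := by
    induction w with
    | nil =>
      rw [TDual.word_nil, map_one]
      exact map_one _
    | cons i w ih =>
      rw [TDual.word_cons, map_mul, TDual.toSDual_ι]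
      refine (map_mul (SymmetricAlgebra.equivMvPolynomial b) _ _).trans ?_
      rw [ih]
      refine (congrArg (· * _) (SymmetricAlgebra.equivMvPolynomial_ι_apply b i)).trans ?_
      rw [← Multiset.cons_coe, ← Multiset.singleton_add, map_add,
        Multiset.toFinsupp_singleton, MvPolynomial.X, MvPolynomial.monomial_mul, one_mul]
  have h' : b.symmetricAlgebra (Multiset.toFinsupp (w : Multiset ι)) =
      (SymmetricAlgebra.equivMvPolynomial b).symm
        (MvPolynomial.monomial (Multiset.toFinsupp (w : Multiset ι)) 1) := by
    rw [Module.Basis.symmetricAlgebra, Module.Basis.map_apply, MvPolynomial.coe_basisMonomials]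
    rfl
  rw [← h] at h'
  exact ((SymmetricAlgebra.equivMvPolynomial b).symm_apply_apply _).symm.trans h'.symm

lemma SDual.sortedSection_word (w : List ι) :
    SDual.sortedSection ρ b (TDual.toSDual ρ (TDual.word ρ b w)) =
      TDual.word ρ b ((w : Multiset ι).sort (· ≤ ·)) := by
  rw [TDual.toSDual_word, SDual.sortedSection, Module.Basis.constr_basis,
    Multiset.toFinsupp_toMultiset]

lemma SDual.sortedSection_one : SDual.sortedSection ρ b 1 = 1 := by
  have := SDual.sortedSection_word ρ b []
  rwa [TDual.word_nil, map_one, Multiset.coe_nil, Multiset.sort_zero, TDual.word_nil] at this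

lemma SDual.sortedSection_ι (x : Module.Dual ℝ V) :
    SDual.sortedSection ρ b (SDual.ι ρ x) = TDual.ι ρ x := by
  suffices h : SDual.sortedSection ρ b ∘ₗ SDual.ι ρ = TDual.ι ρ from DFunLike.congr_fun h x
  refine b.ext fun i => ?_
  have := SDual.sortedSection_word ρ b [i]
  rwa [TDual.word_cons, TDual.word_nil, mul_one, Multiset.coe_singleton, Multiset.sort_singleton,
    TDual.word_cons, TDual.word_nil, mul_one, TDual.toSDual_ι] at this

/-- The right `Γ`-linear section of `T(V*) ⋊ Γ → S(V*) ⋊ Γ` that sends monomials to sorted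
words. -/
def SCross.sortedSection : SCross ρ →ₗ[ℝ] TCross ρ :=
  extendRight (inclCross ∘ₗ SDual.sortedSection ρ b)

lemma SCross.sortedSection_single (γ : Γ) (r : SDual ρ) :
    SCross.sortedSection ρ b (SkewMonoidAlgebra.single γ r) =
      SkewMonoidAlgebra.single γ (SDual.sortedSection ρ b r) := by
  rw [SCross.sortedSection, extendRight_single]
  change SkewMonoidAlgebra.single 1 (SDual.sortedSection ρ b r) * _ = _
  rw [single_mul_single_one, one_mul]

lemma SCross.sortedSection_mul_grp (a : SCross ρ) (γ : Γ) :
    SCross.sortedSection ρ b (a * SCross.grp ρ γ) =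
      SCross.sortedSection ρ b a * TCross.grp ρ γ :=
  extendRight_mul_single _ _ _

lemma SCross.sub_sortedSection_mem {n : ℕ} {t : TCross ρ} (ht : t ∈ TCross.wordsLE ρ n) :
    t - SCross.sortedSection ρ b (TCross.proj ρ t) ∈ TCross.commSpan ρ n := by
  have key : TCross.wordsLE ρ n ≤ (TCross.commSpan ρ n).comap
      (LinearMap.id - SCross.sortedSection ρ b ∘ₗ TCross.proj ρ) := by
    refine TCross.wordsLE_le ρ b fun γ w hw => ?_
    rw [Submodule.mem_comap, LinearMap.sub_apply, LinearMap.id_apply, LinearMap.comp_apply,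
      TCross.proj_single, SCross.sortedSection_single, SDual.sortedSection_word,
      ← TCross.word_mul_grp, ← TCross.word_mul_grp, ← sub_mul]
    have hperm : w.Perm ((w : Multiset ι).sort (· ≤ ·)) := by
      rw [← Multiset.coe_eq_coe, Multiset.sort_eq]
    have hmem := TCross.commSpan_mul_mem ρ (TCross.word_sub_mem_commSpan ρ b hperm)
      (TCross.grp_mem ρ γ)
    rw [add_zero] at hmem
    exact TCross.commSpan_mono ρ hw hmem
  exact key ht

end Words

/-! ### An equivariant section of `T(V*) ⋊ Γ → S(V*) ⋊ Γ` -/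

/-- A linear section of `T(V*) ⋊ Γ → S(V*) ⋊ Γ` that commutes with the left and right
multiplications by `Γ` and respects the length of words. -/
structure EquivariantSection where
  toLin : SCross ρ →ₗ[ℝ] TCross ρ
  grp_mul : ∀ γ a, toLin (SCross.grp ρ γ * a) = TCross.grp ρ γ * toLin a
  mul_grp : ∀ γ a, toLin (a * SCross.grp ρ γ) = toLin a * TCross.grp ρ γ
  one : toLin 1 = 1
  vec : ∀ x, toLin (SCross.vec ρ x) = TCross.vec ρ x
  sub_mem : ∀ {n t}, t ∈ TCross.wordsLE ρ n →
    t - toLin (TCross.proj ρ t) ∈ TCross.commSpan ρ n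

/-- The average over `Γ` of the section that sends monomials to sorted words. -/
def averagedSection [Fintype Γ] {ι : Type*} [LinearOrder ι]
    (b : Module.Basis ι ℝ (Module.Dual ℝ V)) : EquivariantSection ρ :=
  -- Sorting depends on the basis, so it need not commute with left multiplication by `Γ`. Averaging
  -- over `g · s(g⁻¹ ·)` repairs this and keeps right linearity, the values on generators and the
  -- bound on length.
  let s : SCross ρ →ₗ[ℝ] TCross ρ := (Fintype.card Γ : ℝ)⁻¹ • ∑ g : Γ,
      LinearMap.mulLeft ℝ (TCross.grp ρ g) ∘ₗ SCross.sortedSection ρ b ∘ₗ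
        LinearMap.mulLeft ℝ (SCross.grp ρ g⁻¹)
  have hs : ∀ a, s a = (Fintype.card Γ : ℝ)⁻¹ • ∑ g : Γ,
      TCross.grp ρ g * SCross.sortedSection ρ b (SCross.grp ρ g⁻¹ * a) := fun a => by
    simp [s]
  have hcard : (Fintype.card Γ : ℝ) ≠ 0 := Nat.cast_ne_zero.mpr Fintype.card_ne_zero
  have avg : ∀ t : TCross ρ, t = (Fintype.card Γ : ℝ)⁻¹ • ∑ _g : Γ, t := fun t => by
    rw [Finset.sum_const, Finset.card_univ, ← Nat.cast_smul_eq_nsmul ℝ, smul_smul,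
      inv_mul_cancel₀ hcard, one_smul]
  { toLin := s
    grp_mul := fun γ a => by
      rw [hs, hs, mul_smul_comm, Finset.mul_sum]
      congr 1
      refine Fintype.sum_equiv (Equiv.mulLeft γ⁻¹) _ _ fun g => ?_
      rw [← mul_assoc, SCross.grp_mul_grp, ← mul_assoc, TCross.grp_mul_grp]
      simp
    mul_grp := fun γ a => by
      rw [hs, hs, smul_mul_assoc, Finset.sum_mul]
      congr 1
      refine Finset.sum_congr rfl fun g _ => ?_
      rw [← mul_assoc, SCross.sortedSection_mul_grp, mul_assoc]
    one := by
      rw [hs]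
      conv_rhs => rw [avg 1]
      congr 1
      refine Finset.sum_congr rfl fun g _ => ?_
      rw [mul_one, SCross.grp, SCross.sortedSection_single, SDual.sortedSection_one]
      change TCross.grp ρ g * TCross.grp ρ g⁻¹ = _
      rw [TCross.grp_mul_grp, mul_inv_cancel, TCross.grp_one]
    vec := fun x => by
      rw [hs]
      conv_rhs => rw [avg (TCross.vec ρ x)]
      congr 1
      refine Finset.sum_congr rfl fun g _ => ?_
      rw [SCross.grp_mul_vec, SCross.vec, SCross.grp, single_mul_single_one, one_mul,
        SCross.sortedSection_single, SDual.sortedSection_ι, single_eq_mul]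
      change TCross.grp ρ g * (TCross.vec ρ _ * TCross.grp ρ g⁻¹) = _
      rw [← mul_assoc, TCross.grp_mul_vec, mul_assoc, TCross.grp_mul_grp, mul_inv_cancel,
        TCross.grp_one, mul_one, ← Module.End.mul_apply, ← map_mul, mul_inv_cancel, map_one]
      rfl
    sub_mem := fun {n t} ht => by
      rw [hs]
      nth_rewrite 1 [avg t]
      rw [← smul_sub, ← Finset.sum_sub_distrib]
      refine Submodule.smul_mem _ _ (Submodule.sum_mem _ fun g _ => ?_)
      have h1 : TCross.grp ρ g⁻¹ * t ∈ TCross.wordsLE ρ n := by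
        simpa using TCross.mul_mem_wordsLE ρ (TCross.grp_mem ρ g⁻¹) ht
      have h2 := TCross.mul_mem_commSpan ρ (TCross.grp_mem ρ g)
        (SCross.sub_sortedSection_mem ρ b h1)
      rwa [mul_sub, ← mul_assoc, TCross.grp_mul_grp, mul_inv_cancel, TCross.grp_one, one_mul,
        TCross.proj_mul, TCross.proj_grp, zero_add] at h2 }

end

/-! ### The Jacobi identity for constant Poisson structures. -/

section

/-! ### Evaluation of bivectors -/

section Bivector

variable {V : Type*} [AddCommGroup V] [Module ℝ V]

lemma bivectorEval_wedge (v : Fin 2 → V) (x y : Module.Dual ℝ V) :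
    bivectorEval (exteriorPower.ιMulti ℝ 2 v) x y = x (v 0) * y (v 1) - x (v 1) * y (v 0) := by
  rw [bivectorEval, exteriorPower.pairingDual_ιMulti_ιMulti, Matrix.det_fin_two]
  simp [mul_comm]

lemma bivectorEval_add_apply (p q : ⋀[ℝ]^2 V) (x y : Module.Dual ℝ V) :
    bivectorEval (p + q) x y = bivectorEval p x y + bivectorEval q x y := map_add _ _ _

lemma bivectorEval_smul_apply (c : ℝ) (p : ⋀[ℝ]^2 V) (x y : Module.Dual ℝ V) :
    bivectorEval (c • p) x y = c * bivectorEval p x y := map_smul _ _ _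

lemma bivectorEval_zero_apply (x y : Module.Dual ℝ V) :
    bivectorEval (0 : ⋀[ℝ]^2 V) x y = 0 := map_zero _

lemma bivector_induction {P : ⋀[ℝ]^2 V → Prop} (p : ⋀[ℝ]^2 V)
    (wedge : ∀ v : Fin 2 → V, P (exteriorPower.ιMulti ℝ 2 v)) (zero : P 0)
    (add : ∀ p q, P p → P q → P (p + q)) (smul : ∀ (c : ℝ) p, P p → P (c • p)) : P p := by
  have hp : p ∈ Submodule.span ℝ (Set.range (exteriorPower.ιMulti ℝ 2 (M := V))) := by
    rw [exteriorPower.ιMulti_span]; trivial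
  induction hp using Submodule.span_induction with
  | mem p hp => obtain ⟨v, rfl⟩ := hp; exact wedge v
  | zero => exact zero
  | add p q _ _ hp hq => exact add p q hp hq
  | smul c p _ hp => exact smul c p hp

/-- The bilinear form on `V*` given by a bivector. -/
def bivectorForm (p : ⋀[ℝ]^2 V) : Module.Dual ℝ V →ₗ[ℝ] Module.Dual ℝ V →ₗ[ℝ] ℝ :=
  LinearMap.mk₂ ℝ (bivectorEval p)
    (fun x x' y => by
      induction p using bivector_induction with
      | wedge v => simp only [bivectorEval_wedge, LinearMap.add_apply]; ring
      | zero => simp only [bivectorEval_zero_apply]; ring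
      | add p q hp hq => simp only [bivectorEval_add_apply, hp, hq]; ring
      | smul c p hp => simp only [bivectorEval_smul_apply, hp]; ring)
    (fun r x y => by
      induction p using bivector_induction with
      | wedge v => simp only [bivectorEval_wedge, LinearMap.smul_apply, smul_eq_mul]; ring
      | zero => simp only [bivectorEval_zero_apply, smul_eq_mul]; ring
      | add p q hp hq => simp only [bivectorEval_add_apply, hp, hq, smul_eq_mul]; ring
      | smul c p hp => simp only [bivectorEval_smul_apply, hp, smul_eq_mul]; ring)
    (fun x y y' => by
      induction p using bivector_induction with
      | wedge v => simp only [bivectorEval_wedge, LinearMap.add_apply]; ring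
      | zero => simp only [bivectorEval_zero_apply]; ring
      | add p q hp hq => simp only [bivectorEval_add_apply, hp, hq]; ring
      | smul c p hp => simp only [bivectorEval_smul_apply, hp]; ring)
    (fun r x y => by
      induction p using bivector_induction with
      | wedge v => simp only [bivectorEval_wedge, LinearMap.smul_apply, smul_eq_mul]; ring
      | zero => simp only [bivectorEval_zero_apply, smul_eq_mul]; ring
      | add p q hp hq => simp only [bivectorEval_add_apply, hp, hq, smul_eq_mul]; ring
      | smul c p hp => simp only [bivectorEval_smul_apply, hp, smul_eq_mul]; ring)

lemma bivectorForm_apply (p : ⋀[ℝ]^2 V) (x y : Module.Dual ℝ V) :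
    bivectorForm p x y = bivectorEval p x y := rfl

lemma bivectorForm_self (p : ⋀[ℝ]^2 V) (x : Module.Dual ℝ V) : bivectorForm p x x = 0 := by
  simp only [bivectorForm_apply]
  induction p using bivector_induction with
  | wedge v => rw [bivectorEval_wedge]; ring
  | zero => rw [bivectorEval_zero_apply]
  | add p q hp hq => rw [bivectorEval_add_apply, hp, hq, add_zero]
  | smul c p hp => rw [bivectorEval_smul_apply, hp, mul_zero]

lemma bivectorForm_swap (p : ⋀[ℝ]^2 V) (x y : Module.Dual ℝ V) :
    bivectorForm p y x = - bivectorForm p x y := by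
  have h := bivectorForm_self p (x + y)
  simp only [map_add, LinearMap.add_apply, bivectorForm_self] at h
  linarith

lemma bivectorForm_map {W : Type*} [AddCommGroup W] [Module ℝ W] (f : W →ₗ[ℝ] V)
    (p : ⋀[ℝ]^2 W) (x y : Module.Dual ℝ V) :
    bivectorForm (exteriorPower.map 2 f p) x y = bivectorForm p (x ∘ₗ f) (y ∘ₗ f) := by
  simp only [bivectorForm_apply]
  induction p using bivector_induction with
  | wedge v =>
    rw [exteriorPower.map_apply_ιMulti, bivectorEval_wedge, bivectorEval_wedge]
    rfl
  | zero => rw [map_zero, bivectorEval_zero_apply, bivectorEval_zero_apply]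
  | add p q hp hq => rw [map_add, bivectorEval_add_apply, bivectorEval_add_apply, hp, hq]
  | smul c p hp => rw [map_smul, bivectorEval_smul_apply, bivectorEval_smul_apply, hp]

/-- The vector with coefficients `c` pairs to zero with `x`, `y` and `z`, so `(B y z, B z x, B x y)`
is proportional to `c`. Multiplied by a nonzero `c i`, the cyclic sum therefore becomes a multiple
of the dependence `hD`. -/
lemma cyclic_sum_eq_zero {U W : Type*} [AddCommGroup U] [Module ℝ U] [AddCommGroup W]
    [Module ℝ W] (B : U →ₗ[ℝ] U →ₗ[ℝ] ℝ) (hB : ∀ x, B x x = 0)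
    (hB' : ∀ x y, B y x = - B x y) (D : U →ₗ[ℝ] W) (x y z : U)
    (c : Fin 3 → ℝ) (i : Fin 3) (hi : c i ≠ 0) (hD : c 0 • D x + c 1 • D y + c 2 • D z = 0)
    (hc : ∀ u, B u (c 0 • x + c 1 • y + c 2 • z) = 0) :
    B x y • D z + B y z • D x + B z x • D y = 0 := by
  have hx := hc x
  have hy := hc y
  have hz := hc z
  simp only [map_add, map_smul, smul_eq_mul, hB, hB' x z, hB' y z, hB' x y] at hx hy hz
  rw [hB' x z]
  suffices h : c i • (B x y • D z + B y z • D x + -B x z • D y) = 0 from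
    (smul_eq_zero.mp h).resolve_left hi
  fin_cases i
  · have : c 0 • (B x y • D z + B y z • D x + -B x z • D y) =
        B y z • (c 0 • D x + c 1 • D y + c 2 • D z) := by
      have h1 : c 0 * B x y = c 2 * B y z := by linarith
      have h2 : - (c 0 * B x z) = c 1 * B y z := by linarith
      linear_combination (norm := module) h1 • D z + h2 • D y
    rw [hD, smul_zero] at this
    exact this
  · have : c 1 • (B x y • D z + B y z • D x + -B x z • D y) =
        - B x z • (c 0 • D x + c 1 • D y + c 2 • D z) := by
      have h1 : c 1 * B x y = - (c 2 * B x z) := by linarith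
      have h2 : c 1 * B y z = - (c 0 * B x z) := by linarith
      linear_combination (norm := module) h1 • D z + h2 • D x
    rw [hD, smul_zero] at this
    exact this
  · have : c 2 • (B x y • D z + B y z • D x + -B x z • D y) =
        B x y • (c 0 • D x + c 1 • D y + c 2 • D z) := by
      have h1 : - (c 2 * B x z) = c 1 * B x y := by linarith
      have h2 : c 2 * B y z = c 0 * B x y := by linarith
      linear_combination (norm := module) h1 • D y + h2 • D x
    rw [hD, smul_zero] at this
    exact this

lemma exists_dependence_of_finrank_range_le {U W : Type*} [AddCommGroup U] [Module ℝ U]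
    [FiniteDimensional ℝ U] [AddCommGroup W] [Module ℝ W] (D : U →ₗ[ℝ] W)
    (hD : Module.finrank ℝ (LinearMap.range D) ≤ 2) (x y z : U) :
    ∃ (c : Fin 3 → ℝ) (i : Fin 3), c i ≠ 0 ∧ c 0 • D x + c 1 • D y + c 2 • D z = 0 := by
  have hdep : ¬ LinearIndependent ℝ (fun i : Fin 3 => D.rangeRestrict (![x, y, z] i)) := by
    intro h
    have h1 := h.fintype_card_le_finrank.trans hD
    rw [Fintype.card_fin] at h1
    omega
  obtain ⟨c, hc, i, hi⟩ := Fintype.not_linearIndependent_iff.mp hdep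
  refine ⟨c, i, hi, ?_⟩
  have h := congrArg Subtype.val hc
  rw [Fin.sum_univ_three] at h
  exact h

end Bivector

variable {Γ V : Type*} [Group Γ] [AddCommGroup V] [Module ℝ V] {ρ : Representation ℝ Γ V}

lemma dual_comp (g : Γ) (x : Module.Dual ℝ V) : ρ.dual g x ∘ₗ ρ g = x := by
  refine LinearMap.ext fun v => ?_
  change x (ρ g⁻¹ (ρ g v)) = x v
  rw [← Module.End.mul_apply, ← map_mul, inv_mul_cancel, map_one]
  rfl

/-- On `V*` the operator `γ - 1` is the transpose of `γ⁻¹ - 1 = -γ⁻¹ (γ - 1)` on `V`, whose rank is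
at most that of `γ - 1`, the codimension of `V^γ`. -/
lemma finrank_range_dual_sub_one_le [FiniteDimensional ℝ V] (γ : Γ) :
    Module.finrank ℝ (LinearMap.range (ρ.dual γ - 1)) ≤ len ρ γ := by
  have h1 : ρ.dual γ - 1 = (ρ γ⁻¹ - 1 : V →ₗ[ℝ] V).dualMap := by
    ext x v
    exact (map_sub x (ρ γ⁻¹ v) v).symm
  have h2 : (ρ γ⁻¹ - 1 : V →ₗ[ℝ] V) = (-ρ γ⁻¹) ∘ₗ (ρ γ - 1) := by
    refine LinearMap.ext fun v => ?_
    have : ρ γ⁻¹ (ρ γ v) = v := by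
      rw [← Module.End.mul_apply, ← map_mul, inv_mul_cancel, map_one]
      rfl
    simp [this]
  rw [h1, LinearMap.finrank_range_dualMap_eq_finrank_range, h2, LinearMap.range_comp, len,
    fixedSpace, (ρ γ - 1).quotKerEquivRange.finrank_eq]
  exact Submodule.finrank_map_le _ _

namespace ConstantPoisson

variable (π : ConstantPoisson ρ)

/-- The bivector `π_γ` comes from `⋀² N^γ`, and fixed covectors restrict to zero on `N^γ`: they lie
in the radical of `π_γ`. -/
lemma twisted_eq_zero_of_fixed {γ : Γ} {z : Module.Dual ℝ V} (hz : ρ.dual γ z = z)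
    (x : Module.Dual ℝ V) : bivectorForm (π.twisted γ) x z = 0 := by
  by_cases hγ : len ρ γ = 2
  · obtain ⟨p, hp⟩ := π.twisted_mem γ hγ
    rw [← hp, bivectorForm_map]
    have : z ∘ₗ (normalSpace ρ γ).subtype = 0 := by
      refine LinearMap.ext fun v => ?_
      have hv : (v : V) ∈ (LinearMap.ker (ρ.dual γ - 1)).dualCoannihilator := v.2
      rw [Submodule.mem_dualCoannihilator] at hv
      exact hv z (LinearMap.mem_ker.mpr (sub_eq_zero.mpr hz))
    rw [this, map_zero]
  · rw [π.twisted_eq_zero γ hγ, bivectorForm_apply, bivectorEval_zero_apply]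

/-- As `γ - 1` has rank at most two on `V*`, the vectors `γ x - x`, `γ y - y`, `γ z - z` are
dependent. The same combination of `x, y, z` is fixed by `γ`, hence in the radical of `π_γ`, and
`cyclic_sum_eq_zero` applies. -/
lemma twisted_jacobi [FiniteDimensional ℝ V] (γ : Γ) (x y z : Module.Dual ℝ V) :
    bivectorForm (π.twisted γ) x y • (ρ.dual γ z - z) +
      bivectorForm (π.twisted γ) y z • (ρ.dual γ x - x) +
      bivectorForm (π.twisted γ) z x • (ρ.dual γ y - y) = 0 := by
  by_cases hγ : len ρ γ = 2
  swap
  · simp only [bivectorForm_apply, π.twisted_eq_zero γ hγ, bivectorEval_zero_apply, zero_smul,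
      add_zero]
  obtain ⟨c, i, hi, hc⟩ := exists_dependence_of_finrank_range_le (ρ.dual γ - 1)
    ((finrank_range_dual_sub_one_le (ρ := ρ) γ).trans hγ.le) x y z
  have hfix : ρ.dual γ (c 0 • x + c 1 • y + c 2 • z) = c 0 • x + c 1 • y + c 2 • z := by
    rw [← sub_eq_zero, ← hc, ← map_smul, ← map_smul, ← map_smul, ← map_add, ← map_add]
    rfl
  have h := cyclic_sum_eq_zero (bivectorForm (π.twisted γ)) (bivectorForm_self _)
    (bivectorForm_swap _) (ρ.dual γ - 1) x y z c i hi hc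
      fun u => π.twisted_eq_zero_of_fixed hfix u
  simp only [LinearMap.sub_apply, Module.End.one_apply] at h
  exact h

variable [Fintype Γ]

/-- `x, y ↦ π₀(x, y) + ∑_γ π_γ(x, y) γ` as a bilinear map. -/
def valueLin : Module.Dual ℝ V →ₗ[ℝ] Module.Dual ℝ V →ₗ[ℝ] TCross ρ :=
  (bivectorForm π.untwisted).compr₂ (LinearMap.toSpanSingleton ℝ (TCross ρ) 1) +
    ∑ γ : Γ, (bivectorForm (π.twisted γ)).compr₂
      (LinearMap.toSpanSingleton ℝ (TCross ρ) (TCross.grp ρ γ))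

lemma valueLin_apply (x y : Module.Dual ℝ V) : π.valueLin x y =
    bivectorForm π.untwisted x y • (1 : TCross ρ) +
      ∑ γ : Γ, bivectorForm (π.twisted γ) x y • TCross.grp ρ γ := by
  simp [valueLin, LinearMap.sum_apply]

lemma single_algebraMap_eq {R : Type*} [Ring R] [Algebra ℝ R] (γ : Γ) (c : ℝ) :
    SkewMonoidAlgebra.single γ (algebraMap ℝ R c) =
      c • SkewMonoidAlgebra.single γ (1 : R) := by
  rw [SkewMonoidAlgebra.smul_single, Algebra.algebraMap_eq_smul_one]

lemma value_eq_valueLin (x y : Module.Dual ℝ V) : π.value (TDual ρ) x y = π.valueLin x y := by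
  rw [valueLin_apply, value]
  simp only [single_algebraMap_eq]
  rfl

lemma proj_valueLin (x y : Module.Dual ℝ V) :
    TCross.proj ρ (π.valueLin x y) = π.value (SDual ρ) x y := by
  rw [valueLin_apply, value, map_add, map_sum]
  simp only [single_algebraMap_eq, map_smul, TCross.proj_one, TCross.proj_grp]
  rfl

lemma valueLin_self (x : Module.Dual ℝ V) : π.valueLin x x = 0 := by
  simp [valueLin_apply, bivectorForm_self]

lemma valueLin_swap (x y : Module.Dual ℝ V) : π.valueLin x y = - π.valueLin y x := by
  simp only [valueLin_apply]
  rw [bivectorForm_swap _ y x, neg_smul, neg_add, ← Finset.sum_neg_distrib]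
  congr 1
  refine Finset.sum_congr rfl fun γ _ => ?_
  rw [bivectorForm_swap _ y x, neg_smul]

lemma grp_mul_valueLin (g : Γ) (x y : Module.Dual ℝ V) :
    TCross.grp ρ g * π.valueLin x y =
      π.valueLin (ρ.dual g x) (ρ.dual g y) * TCross.grp ρ g := by
  have h0 : bivectorForm π.untwisted (ρ.dual g x) (ρ.dual g y) =
      bivectorForm π.untwisted x y := by
    rw [← π.untwisted_invariant g, bivectorForm_map, dual_comp, dual_comp,
      π.untwisted_invariant g]
  have h1 : ∀ γ, bivectorForm (π.twisted (g * γ * g⁻¹)) (ρ.dual g x) (ρ.dual g y) =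
      bivectorForm (π.twisted γ) x y := fun γ => by
    rw [← π.twisted_invariant g, bivectorForm_map, dual_comp, dual_comp]
  simp only [valueLin_apply, mul_add, add_mul, h0, Finset.mul_sum, Finset.sum_mul]
  congr 1
  · rw [mul_smul_comm, smul_mul_assoc, mul_one, one_mul]
  · refine Fintype.sum_equiv (MulAut.conj g).toEquiv _ _ fun γ => ?_
    change _ = bivectorForm (π.twisted (g * γ * g⁻¹)) (ρ.dual g x) (ρ.dual g y) •
      TCross.grp ρ (g * γ * g⁻¹) * TCross.grp ρ g
    rw [h1, mul_smul_comm, smul_mul_assoc, TCross.grp_mul_grp, TCross.grp_mul_grp,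
      inv_mul_cancel_right]

/-- The untwisted part is a scalar and drops out; moving `γ` past `z` turns `z` into `γ z`. -/
lemma valueLin_mul_vec_sub (x y z : Module.Dual ℝ V) :
    π.valueLin x y * TCross.vec ρ z - TCross.vec ρ z * π.valueLin x y =
      ∑ γ : Γ, TCross.vecLin ρ (bivectorForm (π.twisted γ) x y • (ρ.dual γ z - z)) *
        TCross.grp ρ γ := by
  simp only [valueLin_apply, mul_add, add_mul, Finset.mul_sum, Finset.sum_mul]
  rw [mul_smul_comm, smul_mul_assoc, mul_one, one_mul, add_sub_add_left_eq_sub,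
    ← Finset.sum_sub_distrib]
  refine Finset.sum_congr rfl fun γ _ => ?_
  rw [smul_mul_assoc, mul_smul_comm, TCross.grp_mul_vec, map_smul, map_sub, smul_mul_assoc,
    sub_mul, smul_sub]
  rfl

/-- This is an exact identity in `T(V*) ⋊ Γ`, not only modulo commutators; it holds for each `γ`
separately by `twisted_jacobi`. -/
lemma valueLin_jacobi [FiniteDimensional ℝ V] (x y z : Module.Dual ℝ V) :
    (π.valueLin x y * TCross.vec ρ z - TCross.vec ρ z * π.valueLin x y) +
      (π.valueLin y z * TCross.vec ρ x - TCross.vec ρ x * π.valueLin y z) +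
      (π.valueLin z x * TCross.vec ρ y - TCross.vec ρ y * π.valueLin z x) = 0 := by
  simp only [valueLin_mul_vec_sub]
  rw [← Finset.sum_add_distrib, ← Finset.sum_add_distrib]
  refine Finset.sum_eq_zero fun γ _ => ?_
  rw [← add_mul, ← add_mul, ← map_add, ← map_add, π.twisted_jacobi, map_zero, zero_mul]

/-- A relation trades a commutator of length two for an element of length zero. This drop by two
drives the inductions on length and the estimate on leading terms. -/
lemma valueLin_mem_wordsLE (x y : Module.Dual ℝ V) :
    π.valueLin x y ∈ TCross.wordsLE ρ 0 := by
  rw [valueLin_apply]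
  exact Submodule.add_mem _ (Submodule.smul_mem _ _ (TCross.grp_mem ρ 1))
    (Submodule.sum_mem _ fun γ _ => Submodule.smul_mem _ _ (TCross.grp_mem ρ γ))

end ConstantPoisson

end

/-! ### Existence of the normal form, by recursion on the power of `ħ`. -/

section

variable {Γ V : Type*} [Group Γ] [AddCommGroup V] [Module ℝ V] {ρ : Representation ℝ Γ V}

lemma TCross.hom_ext {M ι : Type*} [AddCommGroup M] [Module ℝ M]
    (b : Module.Basis ι ℝ (Module.Dual ℝ V)) {F G : TCross ρ →ₗ[ℝ] M}
    (h : ∀ w γ, F (TCross.word ρ b w * TCross.grp ρ γ) = G (TCross.word ρ b w * TCross.grp ρ γ)) :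
    F = G := by
  refine LinearMap.ext fun t => ?_
  obtain ⟨n, hn⟩ := TCross.mem_sup_wordsLE ρ t b
  refine (TCross.wordsLE_le ρ b (W := LinearMap.eqLocus F G) fun γ w _ => ?_) hn
  rw [LinearMap.mem_eqLocus, ← TCross.word_mul_grp, h]

namespace EquivariantSection

variable (s : EquivariantSection ρ)

lemma proj_toLin [FiniteDimensional ℝ V] (a : SCross ρ) : TCross.proj ρ (s.toLin a) = a := by
  obtain ⟨t, rfl⟩ := TCross.proj_surjective ρ a
  obtain ⟨n, hn⟩ := TCross.mem_sup_wordsLE ρ t (Module.finBasis ℝ (Module.Dual ℝ V))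
  have := TCross.proj_eq_zero_of_mem_commSpan ρ (s.sub_mem hn)
  rwa [map_sub, sub_eq_zero, eq_comm] at this

/-- By `sub_mem`, `T(V*) ⋊ Γ` is the sum of the image of `s` and the span of the elements `f (x y -
y x) g`. A normal form is prescribed on exactly these two parts, so its properties are checked
there. -/
lemma hom_ext [FiniteDimensional ℝ V] {M : Type*} [AddCommGroup M] [Module ℝ M]
    {F G : TCross ρ →ₗ[ℝ] M} (hs : ∀ a, F (s.toLin a) = G (s.toLin a))
    (hc : ∀ f x y g, F (f * TCross.comm ρ x y * g) = G (f * TCross.comm ρ x y * g)) : F = G := by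
  refine LinearMap.ext fun t => ?_
  obtain ⟨n, hn⟩ := TCross.mem_sup_wordsLE ρ t (Module.finBasis ℝ (Module.Dual ℝ V))
  have h : TCross.commSpan ρ n ≤ LinearMap.eqLocus F G := by
    refine Submodule.span_le.mpr ?_
    rintro _ ⟨i, j, f, g, x, y, -, -, -, rfl⟩
    exact hc f x y g
  have h1 : F _ = G _ := h (s.sub_mem hn)
  rwa [map_sub, map_sub, hs, sub_left_inj] at h1

end EquivariantSection

/-! ### Normal forms -/

/-- The coefficients of the normal form `T(V*) ⋊ Γ → (S(V*) ⋊ Γ)[[ħ]]` determined by a section of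
`T(V*) ⋊ Γ → S(V*) ⋊ Γ` and the relations `x ⊗ y - y ⊗ x = ħ π(x, y)`. -/
structure NormalForm [Fintype Γ] (π : ConstantPoisson ρ) (s : EquivariantSection ρ) where
  N : ℕ → TCross ρ →ₗ[ℝ] SCross ρ
  zero : N 0 = TCross.proj ρ
  succ_toLin : ∀ n a, N (n + 1) (s.toLin a) = 0
  succ_comm : ∀ n f x y g,
    N (n + 1) (f * TCross.comm ρ x y * g) = N n (f * π.valueLin x y * g)

namespace NormalForm

section Construction

variable [Fintype Γ] (π : ConstantPoisson ρ) {ι : Type*} [LinearOrder ι]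
  (b : Module.Basis ι ℝ (Module.Dual ℝ V))

/-- The correction for swapping two letters of a word, in terms of the coefficient of the normal
form in the preceding degree. -/
def swapCorrection (P : TCross ρ →ₗ[ℝ] SCross ρ) (u : List ι) (i j : ι) (v : List ι) : SCross ρ :=
  P (TCross.word ρ b u * π.valueLin (b i) (b j) * TCross.word ρ b v)

/-- For disjoint swaps, `hP` turns both sides into the value of `Q` on the word in which both pairs
are replaced by `π`. For overlapping swaps, the two sides differ by `P` of the Jacobi sum placed
between `u` and `v`. -/
lemma isSwapCorrection [FiniteDimensional ℝ V] {P Q : TCross ρ →ₗ[ℝ] SCross ρ}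
    (hP : ∀ f x y g, P (f * TCross.comm ρ x y * g) = Q (f * π.valueLin x y * g)) :
    IsSwapCorrection (swapCorrection π b P) where
  self u i v := by
    rw [swapCorrection, π.valueLin_self, mul_zero, zero_mul, map_zero]
  antisymm u i j v := by
    rw [swapCorrection, π.valueLin_swap, mul_neg, neg_mul, map_neg, swapCorrection]
  disjoint u i j v k l w := by
    have h1 := hP (TCross.word ρ b u * π.valueLin (b i) (b j) * TCross.word ρ b v) (b k) (b l)
      (TCross.word ρ b w)
    have h2 := hP (TCross.word ρ b u) (b i) (b j)
      (TCross.word ρ b v * π.valueLin (b k) (b l) * TCross.word ρ b w)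
    simp only [swapCorrection, TCross.word_append, TCross.word_cons]
    rw [← map_sub, ← map_sub]
    refine Eq.trans ?_ (h1.trans (Eq.trans ?_ (h2.symm.trans ?_)))
    · congr 1
      rw [TCross.comm_apply]
      noncomm_ring
    · simp only [mul_assoc]
    · congr 1
      rw [TCross.comm_apply]
      noncomm_ring
  overlap u i j k v := by
    have h := congrArg (fun t => P (TCross.word ρ b u * t * TCross.word ρ b v))
      (π.valueLin_jacobi (b i) (b j) (b k))
    simp only [mul_zero, zero_mul, map_zero] at h
    simp only [swapCorrection, TCross.word_append, TCross.word_cons, TCross.word_nil, mul_one]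
    rw [← sub_eq_zero, ← map_add, ← map_add, ← map_add, ← map_add, ← map_sub, ← h,
      π.valueLin_swap (b k) (b i)]
    congr 1
    noncomm_ring

/-- The corrections for sorting words, extended to `T(V*) ⋊ Γ`. -/
def sortMap (P : TCross ρ →ₗ[ℝ] SCross ρ) : TCross ρ →ₗ[ℝ] SCross ρ :=
  extendRight ((TDual.wordBasis ρ b).constr ℝ (sortCorrection (swapCorrection π b P) []))

lemma sortMap_mul_grp (P : TCross ρ →ₗ[ℝ] SCross ρ) (f : TCross ρ) (γ : Γ) :
    sortMap π b P (f * TCross.grp ρ γ) = sortMap π b P f * SCross.grp ρ γ :=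
  extendRight_mul_single _ f γ

lemma sortMap_word (P : TCross ρ →ₗ[ℝ] SCross ρ) (w : List ι) :
    sortMap π b P (TCross.word ρ b w) = sortCorrection (swapCorrection π b P) [] w := by
  rw [sortMap, TCross.word, extendRight_single, ← TDual.wordBasis_apply,
    Module.Basis.constr_basis]
  exact mul_one _

/-- For words around a commutator of basis vectors this is `sort_swap`. It extends bilinearly in `x,
y`, then to all `g` by right `Γ`-linearity, then to all `f` by moving group elements to the right,
past the commutator and past `π(x, y)`, both of which are equivariant. -/
lemma sortMap_comm [FiniteDimensional ℝ V] {P Q : TCross ρ →ₗ[ℝ] SCross ρ}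
    (hP : ∀ f x y g, P (f * TCross.comm ρ x y * g) = Q (f * π.valueLin x y * g))
    (hP' : ∀ f γ, P (f * TCross.grp ρ γ) = P f * SCross.grp ρ γ)
    (f : TCross ρ) (x y : Module.Dual ℝ V) (g : TCross ρ) :
    sortMap π b P (f * TCross.comm ρ x y * g) = P (f * π.valueLin x y * g) := by
  have h1 : ∀ u x y v,
      sortMap π b P (TCross.word ρ b u * TCross.comm ρ x y * TCross.word ρ b v) =
        P (TCross.word ρ b u * π.valueLin x y * TCross.word ρ b v) := by
    intro u x y v
    have h : (TCross.comm ρ).compr₂ (sortMap π b P ∘ₗ LinearMap.mulRight ℝ (TCross.word ρ b v) ∘ₗ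
          LinearMap.mulLeft ℝ (TCross.word ρ b u)) =
        π.valueLin.compr₂ (P ∘ₗ LinearMap.mulRight ℝ (TCross.word ρ b v) ∘ₗ
          LinearMap.mulLeft ℝ (TCross.word ρ b u)) := by
      refine b.ext fun i => b.ext fun j => ?_
      have hij := (isSwapCorrection π b hP).sort_swap i j v u []
      rw [← sortMap_word, ← sortMap_word, ← map_sub, List.nil_append] at hij
      refine Eq.trans ?_ hij
      change sortMap π b P (TCross.word ρ b u * TCross.comm ρ (b i) (b j) * TCross.word ρ b v) = _
      congr 1
      simp only [TCross.word_append, TCross.word_cons, TCross.comm_apply]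
      noncomm_ring
    exact LinearMap.congr_fun₂ h x y
  have h2 : ∀ u x y g, sortMap π b P (TCross.word ρ b u * TCross.comm ρ x y * g) =
      P (TCross.word ρ b u * π.valueLin x y * g) := by
    intro u x y g
    have h : sortMap π b P ∘ₗ LinearMap.mulLeft ℝ (TCross.word ρ b u * TCross.comm ρ x y) =
        P ∘ₗ LinearMap.mulLeft ℝ (TCross.word ρ b u * π.valueLin x y) := by
      refine TCross.hom_ext b fun v γ => ?_
      simp only [LinearMap.comp_apply, LinearMap.mulLeft_apply]
      rw [← mul_assoc, ← mul_assoc, sortMap_mul_grp, hP', h1]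
    exact DFunLike.congr_fun h g
  have h : sortMap π b P ∘ₗ LinearMap.mulRight ℝ (TCross.comm ρ x y * g) =
      P ∘ₗ LinearMap.mulRight ℝ (π.valueLin x y * g) := by
    refine TCross.hom_ext b fun u γ => ?_
    have e1 : TCross.word ρ b u * TCross.grp ρ γ * (TCross.comm ρ x y * g) =
        TCross.word ρ b u * TCross.comm ρ (ρ.dual γ x) (ρ.dual γ y) * (TCross.grp ρ γ * g) := by
      rw [mul_assoc, ← mul_assoc (TCross.grp ρ γ), TCross.grp_mul_comm]
      simp only [mul_assoc]
    have e2 : TCross.word ρ b u * TCross.grp ρ γ * (π.valueLin x y * g) =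
        TCross.word ρ b u * π.valueLin (ρ.dual γ x) (ρ.dual γ y) * (TCross.grp ρ γ * g) := by
      rw [mul_assoc, ← mul_assoc (TCross.grp ρ γ), π.grp_mul_valueLin]
      simp only [mul_assoc]
    simp only [LinearMap.comp_apply, LinearMap.mulRight_apply]
    rw [e1, e2, h2]
  have := DFunLike.congr_fun h f
  simp only [LinearMap.comp_apply, LinearMap.mulRight_apply] at this
  rwa [mul_assoc, mul_assoc]

variable (s : EquivariantSection ρ)

/-- The coefficients of the normal form, defined by recursion. -/
def coefficient : ℕ → TCross ρ →ₗ[ℝ] SCross ρ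
  | 0 => TCross.proj ρ
  | n + 1 => sortMap π b (coefficient n) -
      sortMap π b (coefficient n) ∘ₗ s.toLin ∘ₗ TCross.proj ρ

lemma coefficient_mul_grp (n : ℕ) (f : TCross ρ) (γ : Γ) :
    coefficient π b s n (f * TCross.grp ρ γ) = coefficient π b s n f * SCross.grp ρ γ := by
  cases n with
  | zero => rw [coefficient, TCross.proj_mul, TCross.proj_grp]
  | succ n =>
    simp only [coefficient, LinearMap.sub_apply, LinearMap.comp_apply]
    rw [sortMap_mul_grp, TCross.proj_mul, TCross.proj_grp, s.mul_grp, sortMap_mul_grp, sub_mul]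

/-- The subtracted term of the recursion vanishes on commutators, because the projection kills them;
what remains is `sortMap_comm`. Its hypothesis at one level is the conclusion at the level below,
and at level zero it holds with `Q = 0`. -/
lemma coefficient_succ_comm [FiniteDimensional ℝ V] (n : ℕ) : ∀ f x y g,
    coefficient π b s (n + 1) (f * TCross.comm ρ x y * g) =
      coefficient π b s n (f * π.valueLin x y * g) := by
  have step : ∀ m, (∃ Q : TCross ρ →ₗ[ℝ] SCross ρ, ∀ f x y g,
      coefficient π b s m (f * TCross.comm ρ x y * g) = Q (f * π.valueLin x y * g)) →
      ∀ f x y g, coefficient π b s (m + 1) (f * TCross.comm ρ x y * g) =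
        coefficient π b s m (f * π.valueLin x y * g) := by
    rintro m ⟨Q, hQ⟩ f x y g
    rw [coefficient, LinearMap.sub_apply, LinearMap.comp_apply, LinearMap.comp_apply,
      TCross.proj_mul, TCross.proj_mul, TCross.proj_comm, mul_zero, zero_mul, map_zero, map_zero,
      sub_zero, sortMap_comm π b hQ (coefficient_mul_grp π b s m)]
  induction n with
  | zero =>
    refine step 0 ⟨0, fun f x y g => ?_⟩
    rw [coefficient, TCross.proj_mul, TCross.proj_mul, TCross.proj_comm, mul_zero, zero_mul,
      LinearMap.zero_apply]
  | succ n ih => exact step (n + 1) ⟨_, ih⟩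

/-- The normal form determined by a section. -/
def ofSection [FiniteDimensional ℝ V] : NormalForm π s where
  N := coefficient π b s
  zero := rfl
  succ_toLin n a := by
    rw [coefficient, LinearMap.sub_apply, LinearMap.comp_apply, LinearMap.comp_apply,
      s.proj_toLin, sub_self]
  succ_comm := coefficient_succ_comm π b s

end Construction

end NormalForm

end

/-! ### Associativity of the star product and the class of its first-order term. -/

section

variable {Γ V : Type*} [Group Γ] [AddCommGroup V] [Module ℝ V] {ρ : Representation ℝ Γ V}

/-! ### The star product -/

variable [Fintype Γ] [FiniteDimensional ℝ V] {π : ConstantPoisson ρ} {s : EquivariantSection ρ}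

namespace NormalForm

variable (ν : NormalForm π s)

lemma zero_comm (f : TCross ρ) (x y : Module.Dual ℝ V) (g : TCross ρ) :
    ν.N 0 (f * TCross.comm ρ x y * g) = 0 := by
  rw [ν.zero, TCross.proj_mul, TCross.proj_mul, TCross.proj_comm, mul_zero, zero_mul]

lemma zero_toLin (a : SCross ρ) : ν.N 0 (s.toLin a) = a := by
  rw [ν.zero, s.proj_toLin]

lemma mul_grp (n : ℕ) : ∀ (f : TCross ρ) (γ : Γ),
    ν.N n (f * TCross.grp ρ γ) = ν.N n f * SCross.grp ρ γ := by
  induction n with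
  | zero => intro f γ; rw [ν.zero, TCross.proj_mul, TCross.proj_grp]
  | succ n ih =>
    intro f γ
    suffices h : ν.N (n + 1) ∘ₗ LinearMap.mulRight ℝ (TCross.grp ρ γ) =
        LinearMap.mulRight ℝ (SCross.grp ρ γ) ∘ₗ ν.N (n + 1) from DFunLike.congr_fun h f
    refine s.hom_ext (fun a => ?_) fun f x y g => ?_
    · simp only [LinearMap.comp_apply, LinearMap.mulRight_apply]
      rw [← s.mul_grp, ν.succ_toLin, ν.succ_toLin, zero_mul]
    · simp only [LinearMap.comp_apply, LinearMap.mulRight_apply]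
      rw [mul_assoc _ g, ν.succ_comm, ν.succ_comm, ← mul_assoc, ih]

lemma grp_mul (n : ℕ) : ∀ (γ : Γ) (f : TCross ρ),
    ν.N n (TCross.grp ρ γ * f) = SCross.grp ρ γ * ν.N n f := by
  induction n with
  | zero => intro γ f; rw [ν.zero, TCross.proj_mul, TCross.proj_grp]
  | succ n ih =>
    intro γ f
    suffices h : ν.N (n + 1) ∘ₗ LinearMap.mulLeft ℝ (TCross.grp ρ γ) =
        LinearMap.mulLeft ℝ (SCross.grp ρ γ) ∘ₗ ν.N (n + 1) from DFunLike.congr_fun h f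
    refine s.hom_ext (fun a => ?_) fun f x y g => ?_
    · simp only [LinearMap.comp_apply, LinearMap.mulLeft_apply]
      rw [← s.grp_mul, ν.succ_toLin, ν.succ_toLin, mul_zero]
    · simp only [LinearMap.comp_apply, LinearMap.mulLeft_apply]
      rw [← mul_assoc, ← mul_assoc, ν.succ_comm, ν.succ_comm, mul_assoc _ f, mul_assoc _ (f * _),
        ih]

/-- In series form, `N(s(N f) g) = N(f g)`: a factor may be replaced by its normal form. On `f = s
a` only the term with `N₀ f` survives. On commutators `N₀ f` vanishes, and the remaining terms shift
down by one power of `ħ`. -/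
lemma sum_toLin_mul (n : ℕ) : ∀ f g : TCross ρ,
    ∑ p ∈ Finset.HasAntidiagonal.antidiagonal n, ν.N p.1 (s.toLin (ν.N p.2 f) * g) =
      ν.N n (f * g) := by
  induction n with
  | zero =>
    intro f g
    simp [ν.zero, TCross.proj_mul, s.proj_toLin]
  | succ n ih =>
    intro f g
    suffices h : ∑ p ∈ Finset.HasAntidiagonal.antidiagonal (n + 1),
        ν.N p.1 ∘ₗ LinearMap.mulRight ℝ g ∘ₗ s.toLin ∘ₗ ν.N p.2 =
          ν.N (n + 1) ∘ₗ LinearMap.mulRight ℝ g by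
      have := DFunLike.congr_fun h f
      rwa [LinearMap.sum_apply] at this
    refine s.hom_ext (fun a => ?_) fun f x y f' => ?_
    · simp only [LinearMap.sum_apply, LinearMap.comp_apply, LinearMap.mulRight_apply]
      rw [Finset.Nat.sum_antidiagonal_succ', ν.zero_toLin]
      simp [ν.succ_toLin]
    · simp only [LinearMap.sum_apply, LinearMap.comp_apply, LinearMap.mulRight_apply]
      rw [Finset.Nat.sum_antidiagonal_succ', ν.zero_comm, map_zero, zero_mul, map_zero,
        mul_assoc _ f', ν.succ_comm, ← mul_assoc, ← ih]
      simp only [ν.succ_comm, zero_add]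

lemma sum_mul_toLin (n : ℕ) : ∀ f g : TCross ρ,
    ∑ p ∈ Finset.HasAntidiagonal.antidiagonal n, ν.N p.1 (f * s.toLin (ν.N p.2 g)) =
      ν.N n (f * g) := by
  induction n with
  | zero =>
    intro f g
    simp [ν.zero, TCross.proj_mul, s.proj_toLin]
  | succ n ih =>
    intro f g
    suffices h : ∑ p ∈ Finset.HasAntidiagonal.antidiagonal (n + 1),
        ν.N p.1 ∘ₗ LinearMap.mulLeft ℝ f ∘ₗ s.toLin ∘ₗ ν.N p.2 =
          ν.N (n + 1) ∘ₗ LinearMap.mulLeft ℝ f by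
      have := DFunLike.congr_fun h g
      rwa [LinearMap.sum_apply] at this
    refine s.hom_ext (fun a => ?_) fun g x y g' => ?_
    · simp only [LinearMap.sum_apply, LinearMap.comp_apply, LinearMap.mulLeft_apply]
      rw [Finset.Nat.sum_antidiagonal_succ', ν.zero_toLin]
      simp [ν.succ_toLin]
    · simp only [LinearMap.sum_apply, LinearMap.comp_apply, LinearMap.mulLeft_apply]
      rw [Finset.Nat.sum_antidiagonal_succ', ν.zero_comm, map_zero, mul_zero, map_zero,
        ← mul_assoc, ← mul_assoc, ν.succ_comm, mul_assoc f, mul_assoc f, ← ih]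
      simp only [ν.succ_comm, zero_add]

/-- The star product on `S(V*) ⋊ Γ` determined by the normal form. -/
def deformation : FormalDeformation (SCross ρ) where
  B n := ((LinearMap.mul ℝ (TCross ρ)).compl₁₂ s.toLin s.toLin).compr₂ (ν.N n)
  B_zero a b := by
    change ν.N 0 (s.toLin a * s.toLin b) = a * b
    rw [ν.zero, TCross.proj_mul, s.proj_toLin, s.proj_toLin]
  one_left n a := by
    change ν.N (n + 1) (s.toLin 1 * s.toLin a) = 0
    rw [s.one, one_mul, ν.succ_toLin]
  one_right n a := by
    change ν.N (n + 1) (s.toLin a * s.toLin 1) = 0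
    rw [s.one, mul_one, ν.succ_toLin]
  assoc n a b c := by
    change ∑ p ∈ Finset.HasAntidiagonal.antidiagonal n,
        ν.N p.1 (s.toLin (ν.N p.2 (s.toLin a * s.toLin b)) * s.toLin c) =
      ∑ p ∈ Finset.HasAntidiagonal.antidiagonal n,
        ν.N p.1 (s.toLin a * s.toLin (ν.N p.2 (s.toLin b * s.toLin c)))
    rw [sum_toLin_mul, sum_mul_toLin, mul_assoc]

lemma deformation_B (n : ℕ) (a b : SCross ρ) :
    ν.deformation.B n a b = ν.N n (s.toLin a * s.toLin b) := rfl

lemma isQuantizedBy_deformation : π.IsQuantizedBy ν.deformation := by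
  -- No coboundary is needed: `s` and `N₁` commute with `Γ` on both sides, so `B₁` is already a
  -- cochain relative to `ℝΓ`.
  refine ⟨0, ν.deformation.B 1, fun a b => ?_, fun γ a b => ?_, fun γ a b => ?_, fun γ a b => ?_,
    fun x y => ?_⟩
  · simp
  · simp only [deformation_B]
    rw [s.grp_mul, mul_assoc, ν.grp_mul]
  · simp only [deformation_B]
    rw [s.grp_mul, s.mul_grp, mul_assoc]
  · simp only [deformation_B]
    rw [s.mul_grp, ← mul_assoc, ν.mul_grp]
  · simp only [deformation_B, s.vec]
    have h := ν.succ_comm 0 1 x y 1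
    rw [one_mul, mul_one, one_mul, mul_one, TCross.comm_apply, map_sub, ν.zero,
      π.proj_valueLin] at h
    exact h

end NormalForm

end

/-! ### Power series: the normal form identifies `H_π` with the deformation. -/

section

/-! ### Linear maps of power series -/

section SeriesMap

variable {Γ R S : Type*} [Group Γ] [Ring R] [Algebra ℝ R] [MulSemiringAction Γ R]
  [SMulCommClass Γ ℝ R] [Ring S] [Algebra ℝ S] [MulSemiringAction Γ S] [SMulCommClass Γ ℝ S]

lemma series_smul_def (r : ℝ⟦X⟧) (f : (SkewMonoidAlgebra R Γ)⟦X⟧) :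
    r • f = PowerSeries.map (algebraMap ℝ (SkewMonoidAlgebra R Γ)) r * f := rfl

lemma coeff_series_smul (r : ℝ⟦X⟧) (f : (SkewMonoidAlgebra R Γ)⟦X⟧) (n : ℕ) :
    PowerSeries.coeff n (r • f) = ∑ p ∈ Finset.HasAntidiagonal.antidiagonal n,
      PowerSeries.coeff p.1 r • PowerSeries.coeff p.2 f := by
  rw [series_smul_def, PowerSeries.coeff_mul]
  refine Finset.sum_congr rfl fun p _ => ?_
  rw [PowerSeries.coeff_map, Algebra.smul_def]

lemma X_mul_eq_smul (f : (SkewMonoidAlgebra R Γ)⟦X⟧) :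
    PowerSeries.X * f = (PowerSeries.X : ℝ⟦X⟧) • f := by
  rw [series_smul_def, PowerSeries.map_X]

/-- The `ℝ[[ħ]]`-linear map `∑ ħʲ fⱼ ↦ ∑ ħ^(i + j) Lᵢ(fⱼ)` given by a sequence of linear maps. -/
def seriesMap (L : ℕ → SkewMonoidAlgebra R Γ →ₗ[ℝ] SkewMonoidAlgebra S Γ) :
    (SkewMonoidAlgebra R Γ)⟦X⟧ →ₗ[ℝ⟦X⟧] (SkewMonoidAlgebra S Γ)⟦X⟧ where
  toFun f := PowerSeries.mk fun n => ∑ p ∈ Finset.HasAntidiagonal.antidiagonal n,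
    L p.1 (PowerSeries.coeff p.2 f)
  map_add' f g := by
    ext1 n
    simp only [map_add, PowerSeries.coeff_mk, Finset.sum_add_distrib]
  map_smul' r f := by
    ext1 n
    rw [RingHom.id_apply, coeff_series_smul]
    simp only [PowerSeries.coeff_mk, coeff_series_smul, map_sum, map_smul, Finset.smul_sum]
    rw [Finset.sum_sigma', Finset.sum_sigma']
    -- With `i` the index of `L`, `a` that of the scalar and `b` that of the series, the reindexing
    -- exchanges splitting off `i` first with splitting off `a` first; it is its own inverse.
    refine Finset.sum_nbij' (fun x => ⟨(x.2.1, x.1.1 + x.2.2), (x.1.1, x.2.2)⟩)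
      (fun x => ⟨(x.2.1, x.1.1 + x.2.2), (x.1.1, x.2.2)⟩) ?_ ?_ ?_ ?_ ?_
    · rintro ⟨⟨i, j⟩, ⟨a, b⟩⟩ h
      simp only [Finset.mem_sigma, Finset.HasAntidiagonal.mem_antidiagonal] at h ⊢
      exact ⟨by omega, trivial⟩
    · rintro ⟨⟨i, j⟩, ⟨a, b⟩⟩ h
      simp only [Finset.mem_sigma, Finset.HasAntidiagonal.mem_antidiagonal] at h ⊢
      exact ⟨by omega, trivial⟩
    · rintro ⟨⟨i, j⟩, ⟨a, b⟩⟩ h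
      simp only [Finset.mem_sigma, Finset.HasAntidiagonal.mem_antidiagonal] at h ⊢
      rw [h.2]
    · rintro ⟨⟨i, j⟩, ⟨a, b⟩⟩ h
      simp only [Finset.mem_sigma, Finset.HasAntidiagonal.mem_antidiagonal] at h ⊢
      rw [h.2]
    · intro x _
      rfl

lemma coeff_seriesMap (L : ℕ → SkewMonoidAlgebra R Γ →ₗ[ℝ] SkewMonoidAlgebra S Γ)
    (f : (SkewMonoidAlgebra R Γ)⟦X⟧) (n : ℕ) :
    PowerSeries.coeff n (seriesMap L f) = ∑ p ∈ Finset.HasAntidiagonal.antidiagonal n,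
      L p.1 (PowerSeries.coeff p.2 f) :=
  PowerSeries.coeff_mk n fun n => ∑ p ∈ Finset.HasAntidiagonal.antidiagonal n,
    L p.1 (PowerSeries.coeff p.2 f)

lemma coeff_seriesMap_C (L : ℕ → SkewMonoidAlgebra R Γ →ₗ[ℝ] SkewMonoidAlgebra S Γ)
    (t : SkewMonoidAlgebra R Γ) (n : ℕ) :
    PowerSeries.coeff n (seriesMap L (PowerSeries.C t)) = L n t := by
  rw [coeff_seriesMap, Finset.sum_eq_single (n, 0)]
  · simp
  · rintro ⟨i, j⟩ hij hne
    rw [Finset.HasAntidiagonal.mem_antidiagonal] at hij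
    have hj : j ≠ 0 := fun h => hne (by simp_all)
    simp [PowerSeries.coeff_C, hj]
  · intro h
    exact absurd (Finset.HasAntidiagonal.mem_antidiagonal.mpr (add_zero n)) h

/-- A linear map applied to each coefficient. -/
def coeffMap (L : SkewMonoidAlgebra R Γ →ₗ[ℝ] SkewMonoidAlgebra S Γ) :
    (SkewMonoidAlgebra R Γ)⟦X⟧ →ₗ[ℝ⟦X⟧] (SkewMonoidAlgebra S Γ)⟦X⟧ :=
  seriesMap (Pi.single 0 L)

lemma coeff_coeffMap (L : SkewMonoidAlgebra R Γ →ₗ[ℝ] SkewMonoidAlgebra S Γ)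
    (f : (SkewMonoidAlgebra R Γ)⟦X⟧) (n : ℕ) :
    PowerSeries.coeff n (coeffMap L f) = L (PowerSeries.coeff n f) := by
  rw [coeffMap, coeff_seriesMap, Finset.sum_eq_single (0, n)]
  · simp
  · rintro ⟨i, j⟩ hij hne
    rw [Finset.HasAntidiagonal.mem_antidiagonal] at hij
    have hi : i ≠ 0 := fun h => hne (by simp_all)
    simp [Pi.single_eq_of_ne hi]
  · intro h
    exact absurd (Finset.HasAntidiagonal.mem_antidiagonal.mpr (zero_add n)) h

lemma coeffMap_C (L : SkewMonoidAlgebra R Γ →ₗ[ℝ] SkewMonoidAlgebra S Γ)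
    (t : SkewMonoidAlgebra R Γ) :
    coeffMap L (PowerSeries.C t) = PowerSeries.C (L t) := by
  ext1 n
  rw [coeff_coeffMap, PowerSeries.coeff_C, PowerSeries.coeff_C]
  split_ifs <;> simp

lemma smul_mem_twoSidedIdeal (I : TwoSidedIdeal (SkewMonoidAlgebra R Γ)⟦X⟧) (r : ℝ⟦X⟧)
    {f : (SkewMonoidAlgebra R Γ)⟦X⟧} (hf : f ∈ I) : r • f ∈ I :=
  I.mul_mem_left _ _ hf

end SeriesMap

variable {Γ V : Type*} [Group Γ] [AddCommGroup V] [Module ℝ V] {ρ : Representation ℝ Γ V}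

lemma QuotAlg.mk_eq_mk_iff (J : TwoSidedIdeal (TCross ρ)⟦X⟧) (f g : (TCross ρ)⟦X⟧) :
    QuotAlg.mk J f = QuotAlg.mk J g ↔ f - g ∈ J :=
  (RingCon.eq _).trans (J.rel_iff f g)

lemma QuotAlg.mk_surjective (J : TwoSidedIdeal (TCross ρ)⟦X⟧) :
    Function.Surjective (QuotAlg.mk J) :=
  RingCon.mkₐ_surjective _

lemma le_hbarClosure (J : TwoSidedIdeal (TCross ρ)⟦X⟧) : J ≤ hbarClosure J :=
  le_iInf fun _ => le_sup_left

lemma mem_hbarClosure {J : TwoSidedIdeal (TCross ρ)⟦X⟧} {f : (TCross ρ)⟦X⟧}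
    (h : ∀ n, ∃ g, f - PowerSeries.X ^ n * g ∈ J) : f ∈ hbarClosure J := by
  refine (TwoSidedIdeal.mem_iInf _).mpr fun n => ?_
  obtain ⟨g, hg⟩ := h n
  rw [← sub_add_cancel f (PowerSeries.X ^ n * g)]
  exact TwoSidedIdeal.add_mem _ (TwoSidedIdeal.mem_sup_left hg) (TwoSidedIdeal.mem_sup_right
    (TwoSidedIdeal.mul_mem_right _ _ _ (TwoSidedIdeal.subset_span rfl)))

/-- Words of bounded length span a finite-dimensional space, so a series in them is a finite
combination, with scalar series as coefficients, of constants. This is why the uncompleted tensor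
product `ℝ[[ħ]] ⊗ (S(V*) ⋊ Γ)` suffices for PBW. -/
lemma seriesWordsLE_le_span [FiniteDimensional ℝ V] [Finite Γ] (n : ℕ) : seriesWordsLE ρ n ≤
    Submodule.span ℝ⟦X⟧ ((PowerSeries.C : TCross ρ →+* _) '' TCross.wordsLE ρ n) := by
  set b := Module.finBasis ℝ (Module.Dual ℝ V)
  have hfin : FiniteDimensional ℝ (TCross.wordsLE ρ n) := by
    have hf : ({w : List (Fin _) | w.length ≤ n} : Set (List (Fin (Module.finrank ℝ
        (Module.Dual ℝ V))))).Finite := List.finite_length_le _ n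
    have := FiniteDimensional.span_of_finite ℝ ((Set.finite_univ (α := Γ)).image2
      (fun γ w => SkewMonoidAlgebra.single γ (TDual.word ρ b w)) hf)
    have hle : TCross.wordsLE ρ n ≤ Submodule.span ℝ (Set.image2
        (fun γ w => SkewMonoidAlgebra.single γ (TDual.word ρ b w)) Set.univ
          {w | w.length ≤ n}) :=
      TCross.wordsLE_le ρ b fun γ w hw => Submodule.subset_span ⟨γ, trivial, w, hw, rfl⟩
    exact Submodule.finiteDimensional_of_le hle
  intro f hf
  let e := Module.finBasis ℝ (TCross.wordsLE ρ n)
  have hsum : f = ∑ i, (PowerSeries.mk fun m => e.repr ⟨PowerSeries.coeff m f, hf m⟩ i) •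
      PowerSeries.C (e i : TCross ρ) := by
    ext1 m
    rw [map_sum]
    have h1 := congrArg Subtype.val (e.sum_repr ⟨PowerSeries.coeff m f, hf m⟩)
    rw [Submodule.coe_sum] at h1
    refine h1.symm.trans (Finset.sum_congr rfl fun i _ => ?_)
    rw [coeff_series_smul, Finset.sum_eq_single (m, 0)]
    · simp
    · rintro ⟨i, j⟩ hij hne
      rw [Finset.HasAntidiagonal.mem_antidiagonal] at hij
      have hj : j ≠ 0 := fun h => hne (by simp_all)
      simp [PowerSeries.coeff_C, hj]
    · intro h
      exact absurd (Finset.HasAntidiagonal.mem_antidiagonal.mpr (add_zero m)) h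
  rw [hsum]
  exact Submodule.sum_mem _ fun i _ => Submodule.smul_mem _ _
    (Submodule.subset_span ⟨_, (e i).2, rfl⟩)

/-! ### The normal form of power series -/

variable [Fintype Γ] [FiniteDimensional ℝ V] {π : ConstantPoisson ρ} {s : EquivariantSection ρ}

namespace NormalForm

variable (ν : NormalForm π s)

/-- The normal form `(T(V*) ⋊ Γ)[[ħ]] → (S(V*) ⋊ Γ)[[ħ]]`. -/
def series : (TCross ρ)⟦X⟧ →ₗ[ℝ⟦X⟧] (SCross ρ)⟦X⟧ := seriesMap ν.N

lemma series_coeffMap (f : (SCross ρ)⟦X⟧) : ν.series (coeffMap s.toLin f) = f := by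
  ext1 n
  rw [series, coeff_seriesMap, Finset.sum_eq_single (0, n)]
  · rw [coeff_coeffMap, ν.zero_toLin]
  · rintro ⟨i, j⟩ hij hne
    rw [Finset.HasAntidiagonal.mem_antidiagonal] at hij
    obtain ⟨k, rfl⟩ := Nat.exists_eq_succ_of_ne_zero (fun h => hne (by simp_all) : i ≠ 0)
    rw [coeff_coeffMap, ν.succ_toLin]
  · intro h
    exact absurd (Finset.HasAntidiagonal.mem_antidiagonal.mpr (zero_add n)) h

lemma star_eq (f g : (SCross ρ)⟦X⟧) : ν.deformation.star f g =
    ν.series (coeffMap s.toLin f * coeffMap s.toLin g) := by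
  ext1 n
  rw [FormalDeformation.star, PowerSeries.coeff_mk, series, coeff_seriesMap]
  refine Finset.sum_congr rfl fun p _ => ?_
  rw [PowerSeries.coeff_mul, map_sum]
  refine Finset.sum_congr rfl fun q _ => ?_
  rw [coeff_coeffMap, coeff_coeffMap, deformation_B]

lemma series_comm (F G : (TCross ρ)⟦X⟧) (x y : Module.Dual ℝ V) :
    ν.series (F * PowerSeries.C (TCross.comm ρ x y) * G) =
      PowerSeries.X * ν.series (F * PowerSeries.C (π.valueLin x y) * G) := by
  have h0 : ∀ m, ν.N 0 (PowerSeries.coeff m (F * PowerSeries.C (TCross.comm ρ x y) * G)) = 0 := by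
    intro m
    rw [PowerSeries.coeff_mul, map_sum]
    refine Finset.sum_eq_zero fun p _ => ?_
    rw [PowerSeries.coeff_mul_C, ν.zero_comm]
  ext1 n
  rw [series, coeff_seriesMap]
  cases n with
  | zero =>
    rw [PowerSeries.coeff_zero_X_mul, Finset.Nat.antidiagonal_zero, Finset.sum_singleton, h0]
  | succ n =>
    rw [PowerSeries.coeff_succ_X_mul, coeff_seriesMap, Finset.Nat.sum_antidiagonal_succ, h0,
      zero_add]
    refine Finset.sum_congr rfl fun p _ => ?_
    rw [PowerSeries.coeff_mul, PowerSeries.coeff_mul, map_sum, map_sum]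
    refine Finset.sum_congr rfl fun q _ => ?_
    rw [PowerSeries.coeff_mul_C, PowerSeries.coeff_mul_C, ν.succ_comm]

lemma series_X_mul (F : (TCross ρ)⟦X⟧) :
    ν.series (PowerSeries.X * F) = PowerSeries.X * ν.series F := by
  rw [X_mul_eq_smul, map_smul, X_mul_eq_smul]

lemma series_X_pow_mul (n : ℕ) (F : (TCross ρ)⟦X⟧) :
    ν.series (PowerSeries.X ^ n * F) = PowerSeries.X ^ n * ν.series F := by
  induction n with
  | zero => rw [pow_zero, pow_zero, one_mul, one_mul]
  | succ n ih => rw [pow_succ', pow_succ', mul_assoc, mul_assoc, series_X_mul, ih]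

/-- The largest two-sided ideal on which the normal form vanishes modulo `ħⁿ`. -/
def vanishingIdeal (n : ℕ) : TwoSidedIdeal (TCross ρ)⟦X⟧ :=
  TwoSidedIdeal.mk' {f | ∀ a b, ∀ m < n, PowerSeries.coeff m (ν.series (a * f * b)) = 0}
    (fun a b m _ => by rw [mul_zero, zero_mul, map_zero, map_zero])
    (fun {f g} hf hg a b m hm => by
      rw [mul_add, add_mul, map_add, map_add, hf a b m hm, hg a b m hm, add_zero])
    (fun {f} hf a b m hm => by
      rw [mul_neg, neg_mul, map_neg, map_neg, hf a b m hm, neg_zero])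
    (fun {f g} hg a b m hm => by
      rw [← mul_assoc]; exact hg (a * f) b m hm)
    (fun {f g} hf a b m hm => by
      rw [← mul_assoc, mul_assoc]; exact hf a (g * b) m hm)

lemma mem_vanishingIdeal {n : ℕ} {f : (TCross ρ)⟦X⟧} : f ∈ ν.vanishingIdeal n ↔
    ∀ a b, ∀ m < n, PowerSeries.coeff m (ν.series (a * f * b)) = 0 :=
  TwoSidedIdeal.mem_mk' ..

lemma relIdeal_le (n : ℕ) : π.relIdeal ≤ ν.vanishingIdeal n := by
  refine TwoSidedIdeal.span_le.mpr ?_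
  rintro _ ⟨x, y, rfl⟩
  refine ν.mem_vanishingIdeal.mpr fun a b m _ => ?_
  rw [← TCross.comm_apply, π.value_eq_valueLin, mul_sub, sub_mul, map_sub, series_comm,
    ← mul_assoc, ← PowerSeries.X_mul, mul_assoc PowerSeries.X, mul_assoc PowerSeries.X,
    series_X_mul, sub_self, map_zero]

/-- Modulo each power of `ħ`, the ideal of relations and the power of `(ħ)` added to it both lie in
`vanishingIdeal`. Working with an ideal avoids the question whether the kernel of `N` itself is one.
-/
lemma series_eq_zero_of_mem {f : (TCross ρ)⟦X⟧} (hf : f ∈ hbarClosure π.relIdeal) :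
    ν.series f = 0 := by
  ext1 m
  have h : hbarClosure π.relIdeal ≤ ν.vanishingIdeal (m + 1) := by
    refine (iInf_le _ (m + 1)).trans (sup_le (ν.relIdeal_le _) (TwoSidedIdeal.span_le.mpr ?_))
    rw [Set.singleton_subset_iff]
    refine ν.mem_vanishingIdeal.mpr fun a b k hk => ?_
    rw [← PowerSeries.X_pow_mul, mul_assoc, series_X_pow_mul, PowerSeries.coeff_X_pow_mul',
      if_neg (by omega)]
  have := ν.mem_vanishingIdeal.mp (h hf) 1 1 m (Nat.lt_succ_self m)
  rwa [one_mul, mul_one] at this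

/-- The difference between a power series and the representative given by its normal form. -/
def defect : (TCross ρ)⟦X⟧ →ₗ[ℝ⟦X⟧] (TCross ρ)⟦X⟧ :=
  LinearMap.id - coeffMap s.toLin ∘ₗ ν.series

lemma defect_apply (f : (TCross ρ)⟦X⟧) :
    ν.defect f = f - coeffMap s.toLin (ν.series f) := rfl

lemma defect_toLin (a : SCross ρ) : ν.defect (PowerSeries.C (s.toLin a)) = 0 := by
  rw [defect_apply, ← coeffMap_C, series_coeffMap, sub_self]

/-- The normal form of the commutator term is `ħ` times that of the `π` term, so the parts in the
image of `s` cancel. The rest is a generator of `I_π` multiplied on both sides. -/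
lemma defect_comm_sub_mem (f g : TCross ρ) (x y : Module.Dual ℝ V) :
    ν.defect (PowerSeries.C (f * TCross.comm ρ x y * g)) -
      PowerSeries.X * ν.defect (PowerSeries.C (f * π.valueLin x y * g)) ∈ π.relIdeal := by
  have h1 : PowerSeries.C (TCross.comm ρ x y) -
      PowerSeries.X * PowerSeries.C (π.valueLin x y) ∈ π.relIdeal := by
    refine TwoSidedIdeal.subset_span ⟨x, y, ?_⟩
    rw [π.value_eq_valueLin, TCross.comm_apply]
  have h2 := π.relIdeal.mul_mem_right _ (PowerSeries.C g)
    (π.relIdeal.mul_mem_left (PowerSeries.C f) _ h1)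
  have h3 : PowerSeries.X * coeffMap s.toLin
      (ν.series (PowerSeries.C f * PowerSeries.C (π.valueLin x y) * PowerSeries.C g)) =
        coeffMap s.toLin
          (ν.series (PowerSeries.C f * PowerSeries.C (TCross.comm ρ x y) * PowerSeries.C g)) := by
    rw [series_comm, X_mul_eq_smul, X_mul_eq_smul, map_smul]
  convert! h2 using 1
  simp only [defect_apply, map_mul]
  rw [mul_sub PowerSeries.X, h3, mul_sub, sub_mul, ← mul_assoc (PowerSeries.C f) PowerSeries.X,
    ← PowerSeries.X_mul, mul_assoc PowerSeries.X, mul_assoc PowerSeries.X]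
  abel

/-- Modulo the image of `s`, where the defect vanishes, an element is a sum of commutator terms.
Each is `ħ` times a term shorter by two letters modulo `I_π`, so the process stops and no closure is
needed here. -/
lemma defect_C_mem_of_mem_wordsLE (n : ℕ) :
    ∀ t ∈ TCross.wordsLE ρ n, ν.defect (PowerSeries.C t) ∈ π.relIdeal := by
  induction n using Nat.strong_induction_on with
  | _ n ih =>
    intro t ht
    have key : ∀ q ∈ TCross.commSpan ρ n, ν.defect (PowerSeries.C q) ∈ π.relIdeal := by
      intro q hq
      induction hq using Submodule.span_induction with
      | mem q hq =>
        obtain ⟨i, j, f, g, x, y, hf, hg, hij, rfl⟩ := hq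
        have h1 : ν.defect (PowerSeries.C (f * π.valueLin x y * g)) ∈ π.relIdeal :=
          ih (i + 0 + j) (by omega) _ (TCross.mul_mem_wordsLE ρ
            (TCross.mul_mem_wordsLE ρ hf (π.valueLin_mem_wordsLE x y)) hg)
        have h2 := TwoSidedIdeal.add_mem _ (ν.defect_comm_sub_mem f g x y)
          (π.relIdeal.mul_mem_left PowerSeries.X _ h1)
        rwa [sub_add_cancel] at h2
      | zero => rw [map_zero, map_zero]; exact TwoSidedIdeal.zero_mem _
      | add x y _ _ hx hy => rw [map_add, map_add]; exact TwoSidedIdeal.add_mem _ hx hy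
      | smul c x _ hx =>
        have : PowerSeries.C (c • x) = (PowerSeries.C c : ℝ⟦X⟧) • (PowerSeries.C x) := by
          rw [series_smul_def, PowerSeries.map_C, ← map_mul, ← Algebra.smul_def]
        rw [this, map_smul]
        exact smul_mem_twoSidedIdeal _ _ hx
    have h := key _ (s.sub_mem ht)
    rwa [map_sub, map_sub, defect_toLin, sub_zero] at h

lemma defect_C_mem (t : TCross ρ) : ν.defect (PowerSeries.C t) ∈ π.relIdeal := by
  obtain ⟨n, hn⟩ := TCross.mem_sup_wordsLE ρ t (Module.finBasis ℝ (Module.Dual ℝ V))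
  exact ν.defect_C_mem_of_mem_wordsLE n t hn

/-- Peeling off constant coefficients one at a time leaves a remainder divisible by any given power
of `ħ`. The word lengths of the coefficients may be unbounded, hence the closure in the conclusion.
-/
lemma defect_mem_hbarClosure (f : (TCross ρ)⟦X⟧) : ν.defect f ∈ hbarClosure π.relIdeal := by
  refine mem_hbarClosure fun n => ?_
  induction n generalizing f with
  | zero => exact ⟨ν.defect f, by rw [pow_zero, one_mul, sub_self]; exact TwoSidedIdeal.zero_mem _⟩
  | succ n ih =>
    obtain ⟨g, hg⟩ := ih (PowerSeries.mk fun m => PowerSeries.coeff (m + 1) f)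
    refine ⟨g, ?_⟩
    have h1 := TwoSidedIdeal.add_mem _ (π.relIdeal.mul_mem_left PowerSeries.X _ hg)
      (ν.defect_C_mem (PowerSeries.constantCoeff f))
    convert! h1 using 1
    nth_rewrite 1 [PowerSeries.eq_X_mul_shift_add_const f]
    rw [map_add, X_mul_eq_smul, map_smul, ← X_mul_eq_smul, mul_sub, pow_succ', mul_assoc]
    abel

/-- The isomorphism is `s` followed by the quotient map. It is injective because `N ∘ s = id` and
`N` kills the closure, surjective because every defect lies in the closure, and its inverse is
induced by `N`. -/
theorem hIsQuantization (ν : NormalForm π s) : π.HIsQuantization := by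
  have hmk : ∀ f, QuotAlg.mk (hbarClosure π.relIdeal) (coeffMap s.toLin (ν.series f)) =
      QuotAlg.mk (hbarClosure π.relIdeal) f := fun f =>
    ((QuotAlg.mk_eq_mk_iff _ _ _).mpr (ν.defect_mem_hbarClosure f)).symm
  let φ : (SCross ρ)⟦X⟧ →ₗ[ℝ⟦X⟧] π.H :=
    (QuotAlg.mk (hbarClosure π.relIdeal)).toLinearMap ∘ₗ coeffMap s.toLin
  have hφ : ∀ f, φ f = QuotAlg.mk (hbarClosure π.relIdeal) (coeffMap s.toLin f) := fun _ => rfl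
  have hinj : Function.Injective φ := by
    rw [← LinearMap.ker_eq_bot, LinearMap.ker_eq_bot']
    intro f hf
    rw [hφ, ← map_zero (QuotAlg.mk (hbarClosure π.relIdeal)), QuotAlg.mk_eq_mk_iff, sub_zero] at hf
    rw [← ν.series_coeffMap f, ν.series_eq_zero_of_mem hf]
  have hsurj : Function.Surjective φ := by
    intro h
    obtain ⟨f, rfl⟩ := QuotAlg.mk_surjective _ h
    exact ⟨ν.series f, hmk f⟩
  refine ⟨ν.deformation, ν.isQuantizedBy_deformation, LinearEquiv.ofBijective φ ⟨hinj, hsurj⟩,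
    fun f g => ?_, fun t => ?_⟩
  · change φ _ = φ f * φ g
    rw [hφ, hφ, hφ, star_eq, hmk, map_mul]
  · have : (LinearEquiv.ofBijective φ ⟨hinj, hsurj⟩).symm
        (QuotAlg.mk (hbarClosure π.relIdeal) (PowerSeries.C t)) =
          ν.series (PowerSeries.C t) := by
      rw [LinearEquiv.symm_apply_eq]
      exact (hmk _).symm
    rw [this, ← PowerSeries.coeff_zero_eq_constantCoeff_apply, series, coeff_seriesMap_C, ν.zero,
      TCross.proj_eq_toSCross]

end NormalForm

end

/-! ### Symbols, homomorphisms out of `S(V*) ⋊ Γ`, and homogeneous components. -/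

section

/-! ### Symbols -/

namespace AlgFiltration

variable {k A : Type*} [CommRing k] [Ring A] [Algebra k A] (F : AlgFiltration k A)

/-- `a ↦ a tⁿ`, as a map to the Rees algebra. -/
def monomial (n : ℕ) : F.deg n →ₗ[k] F.rees where
  toFun a := ⟨Polynomial.monomial n (a : A), fun m => by
    rw [Polynomial.coeff_monomial]
    split_ifs with h
    · exact h ▸ a.2
    · exact Submodule.zero_mem _⟩
  map_add' a b := Subtype.ext (map_add (Polynomial.monomial n) (a : A) b)
  map_smul' r a := Subtype.ext (Polynomial.smul_monomial r n (a : A)).symm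

/-- The quotient map from the Rees algebra to the associated graded algebra. -/
def toGr : F.rees →ₐ[k] F.Gr := RingCon.mkₐ k F.lower.ringCon

lemma toGr_monomial (n : ℕ) (a : F.deg n) : F.toGr (F.monomial n a) = F.symbol n a := rfl

lemma toGr_surjective : Function.Surjective F.toGr := RingCon.mkₐ_surjective _

lemma toGr_eq_zero_iff (p : F.rees) :
    F.toGr p = 0 ↔ ∀ n, (p : Polynomial A).coeff n ∈ F.pred n := by
  rw [← map_zero F.toGr]
  refine (RingCon.eq _).trans ((F.lower.rel_iff p 0).trans ?_)
  rw [sub_zero]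
  exact TwoSidedIdeal.mem_mk' ..

lemma rees_eq_sum (p : F.rees) :
    p = ∑ n ∈ (p : Polynomial A).support, F.monomial n ⟨_, p.2 n⟩ := by
  refine Subtype.ext ?_
  rw [AddSubmonoidClass.coe_finsetSum]
  exact (p : Polynomial A).as_sum_support

lemma symbol_mul_symbol {m n l : ℕ} (a : F.deg m) (b : F.deg n) (c : F.deg l) (hl : m + n = l)
    (hc : (c : A) = a * b) : F.symbol m a * F.symbol n b = F.symbol l c := by
  subst hl
  rw [← toGr_monomial, ← toGr_monomial, ← toGr_monomial, ← map_mul]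
  congr 1
  refine Subtype.ext ?_
  change Polynomial.monomial m (a : A) * Polynomial.monomial n (b : A) =
    Polynomial.monomial (m + n) (c : A)
  rw [Polynomial.monomial_mul_monomial, hc]

lemma symbol_eq_zero {n : ℕ} (a : F.deg n) (ha : (a : A) ∈ F.pred n) : F.symbol n a = 0 := by
  rw [← toGr_monomial, toGr_eq_zero_iff]
  intro m
  change (Polynomial.monomial n (a : A)).coeff m ∈ _
  rw [Polynomial.coeff_monomial]
  split_ifs with h
  · exact h ▸ ha
  · exact Submodule.zero_mem _

lemma symbol_one (a : F.deg 0) (ha : (a : A) = 1) : F.symbol 0 a = 1 := by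
  rw [← toGr_monomial, ← map_one F.toGr]
  congr 1
  refine Subtype.ext ?_
  change Polynomial.monomial 0 (a : A) = 1
  rw [ha, Polynomial.monomial_zero_one]

end AlgFiltration

variable {Γ V : Type*} [Group Γ] [AddCommGroup V] [Module ℝ V] {ρ : Representation ℝ Γ V}

/-! ### Homomorphisms from `S(V*) ⋊ Γ` -/

section Lift

variable [Fintype Γ] [FiniteDimensional ℝ V] {G : Type*} [Ring G] [Algebra ℝ G]

lemma TDual.hom_smul (v : Module.Dual ℝ V →ₗ[ℝ] G) (g : Γ →* G)
    (hg : ∀ γ x, g γ * v x = v (ρ.dual γ x) * g γ) (F : TDual ρ →ₐ[ℝ] G)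
    (hF : ∀ x, F (TDual.ι ρ x) = v x) (γ : Γ) (t : TDual ρ) :
    F (γ • t) * g γ = g γ * F t := by
  refine TensorAlgebra.induction (C := fun t : TDual ρ => F (γ • t) * g γ = g γ * F t)
    ?_ ?_ ?_ ?_ t
  · intro r
    change F (TDual.act ρ γ (algebraMap ℝ (TDual ρ) r)) * g γ = g γ * F (algebraMap ℝ (TDual ρ) r)
    rw [AlgHom.commutes, AlgHom.commutes, Algebra.commutes]
  · intro x
    change F (γ • TDual.ι ρ x) * g γ = g γ * F (TDual.ι ρ x)
    rw [TDual.smul_ι, hF, hF, hg]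
  · intro a b ha hb
    have ha' : F (γ • (show TDual ρ from a)) * g γ = g γ * F a := ha
    have hb' : F (γ • (show TDual ρ from b)) * g γ = g γ * F b := hb
    change F (γ • ((show TDual ρ from a) * (show TDual ρ from b))) * g γ =
      g γ * F ((show TDual ρ from a) * (show TDual ρ from b))
    rw [smul_mul', map_mul, map_mul, mul_assoc, hb', ← mul_assoc, ha', mul_assoc]
  · intro a b ha hb
    have ha' : F (γ • (show TDual ρ from a)) * g γ = g γ * F a := ha
    have hb' : F (γ • (show TDual ρ from b)) * g γ = g γ * F b := hb
    change F (γ • ((show TDual ρ from a) + (show TDual ρ from b))) * g γ =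
      g γ * F ((show TDual ρ from a) + (show TDual ρ from b))
    rw [smul_add, map_add, map_add, add_mul, mul_add, ha', hb']

/-- Compatible images of `V*` and `Γ` define a homomorphism from `T(V*) ⋊ Γ`. -/
lemma TCross.exists_hom (v : Module.Dual ℝ V →ₗ[ℝ] G) (g : Γ →* G)
    (hg : ∀ γ x, g γ * v x = v (ρ.dual γ x) * g γ) :
    ∃ Ψ : TCross ρ →ₐ[ℝ] G, (∀ x, Ψ (TCross.vec ρ x) = v x) ∧
      ∀ γ, Ψ (TCross.grp ρ γ) = g γ := by
  let F : TDual ρ →ₐ[ℝ] G := TensorAlgebra.lift ℝ v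
  have hF : ∀ x, F (TDual.ι ρ x) = v x := fun x => TensorAlgebra.lift_ι_apply v x
  let Ψ : TCross ρ →+* G := SkewMonoidAlgebra.liftNCRingHom (F : TDual ρ →+* G) g
    (fun {t γ} => TDual.hom_smul v g hg F hF γ t)
  have hΨ : ∀ γ t, Ψ (SkewMonoidAlgebra.single γ t) = F t * g γ := fun γ t =>
    SkewMonoidAlgebra.liftNC_single _ _ _ _
  refine ⟨{ Ψ with
    commutes' := fun r => ?_ }, fun x => ?_, fun γ => ?_⟩
  · change Ψ _ = _
    rw [crossAlgebraMap_apply, hΨ, map_one, mul_one, AlgHom.commutes]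
  · change Ψ _ = _
    rw [TCross.vec, hΨ, map_one, mul_one, hF]
  · change Ψ _ = _
    rw [TCross.grp, hΨ, map_one, one_mul]

/-- Commuting images of `V*`, compatible with images of `Γ`, define a homomorphism from
`S(V*) ⋊ Γ`. -/
lemma SCross.exists_hom (s : EquivariantSection ρ) (v : Module.Dual ℝ V →ₗ[ℝ] G) (g : Γ →* G)
    (hg : ∀ γ x, g γ * v x = v (ρ.dual γ x) * g γ) (hv : ∀ x y, v x * v y = v y * v x) :
    ∃ Ψ : SCross ρ →ₐ[ℝ] G, (∀ x, Ψ (SCross.vec ρ x) = v x) ∧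
      ∀ γ, Ψ (SCross.grp ρ γ) = g γ := by
  obtain ⟨Φ, hΦv, hΦg⟩ := TCross.exists_hom v g hg
  -- `Φ` kills commutators, hence factors through the projection, and `Φ ∘ s` is the factorization.
  have h : Φ.toLinearMap ∘ₗ s.toLin ∘ₗ TCross.proj ρ = Φ.toLinearMap := by
    refine s.hom_ext (fun a => ?_) fun f x y g' => ?_
    · rw [LinearMap.comp_apply, LinearMap.comp_apply, s.proj_toLin]
    · have hc : Φ (TCross.comm ρ x y) = 0 := by
        rw [TCross.comm_apply, map_sub, map_mul, map_mul, hΦv, hΦv, hv, sub_self]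
      rw [LinearMap.comp_apply, LinearMap.comp_apply, TCross.proj_mul, TCross.proj_mul,
        TCross.proj_comm, mul_zero, zero_mul, map_zero, map_zero, AlgHom.toLinearMap_apply,
        map_mul, map_mul, hc, mul_zero, zero_mul]
  have h' : ∀ t, Φ (s.toLin (TCross.proj ρ t)) = Φ t := DFunLike.congr_fun h
  refine ⟨AlgHom.ofLinearMap (Φ.toLinearMap ∘ₗ s.toLin) ?_ ?_, fun x => ?_, fun γ => ?_⟩
  · change Φ (s.toLin 1) = 1
    rw [s.one, map_one]
  · intro a b
    change Φ (s.toLin (a * b)) = Φ (s.toLin a) * Φ (s.toLin b)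
    rw [← map_mul, ← h' (s.toLin a * s.toLin b), TCross.proj_mul, s.proj_toLin, s.proj_toLin]
  · change Φ (s.toLin (SCross.vec ρ x)) = v x
    rw [s.vec, hΦv]
  · change Φ (s.toLin (SCross.grp ρ γ)) = g γ
    rw [← TCross.proj_grp, h', hΦg]

/-- Linearity of `v` over `ℝ` is expressed through constant series, since `G` is given only as an
algebra over `ℝ[[ħ]]`; the real structure is its restriction. -/
lemma exists_baseChange_hom {G : Type*} [Ring G] [Algebra ℝ⟦X⟧ G] (s : EquivariantSection ρ)
    (v : Module.Dual ℝ V → G) (hadd : ∀ x y, v (x + y) = v x + v y)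
    (hsmul : ∀ (r : ℝ) x, v (r • x) = (PowerSeries.C r : ℝ⟦X⟧) • v x) (g : Γ →* G)
    (hg : ∀ γ x, g γ * v x = v (ρ.dual γ x) * g γ) (hv : ∀ x y, v x * v y = v y * v x) :
    ∃ Ψ : ℝ⟦X⟧ ⊗[ℝ] SCross ρ →ₐ[ℝ⟦X⟧] G, (∀ x, Ψ (1 ⊗ₜ SCross.vec ρ x) = v x) ∧
      ∀ γ, Ψ (1 ⊗ₜ SCross.grp ρ γ) = g γ := by
  let _ : Algebra ℝ G := Algebra.compHom G (algebraMap ℝ ℝ⟦X⟧)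
  have : IsScalarTower ℝ ℝ⟦X⟧ G := IsScalarTower.of_algebraMap_eq fun _ => rfl
  obtain ⟨Φ, hΦv, hΦg⟩ := SCross.exists_hom s
    { toFun := v
      map_add' := hadd
      map_smul' := hsmul } g hg hv
  have hc : ∀ r a, Commute (Algebra.ofId ℝ⟦X⟧ G r) (Φ a) := fun r a => Algebra.commutes r _
  refine ⟨Algebra.TensorProduct.lift (Algebra.ofId ℝ⟦X⟧ G) Φ hc, fun x => ?_, fun γ => ?_⟩
  · rw [Algebra.TensorProduct.lift_tmul, map_one, one_mul, hΦv]
    rfl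
  · rw [Algebra.TensorProduct.lift_tmul, map_one, one_mul, hΦg]

end Lift

/-- Injectivity of a linear map from `ℝ[[ħ]] ⊗ (S(V*) ⋊ Γ)`, detected by a relation to the canonical
map to `(S(V*) ⋊ Γ)[[ħ]]`. -/
lemma injective_of_relation {P G : Type*} [AddCommGroup P] [Module ℝ⟦X⟧ P] [AddCommGroup G]
    [Module ℝ⟦X⟧ G] (Ψ : ℝ⟦X⟧ ⊗[ℝ] SCross ρ →ₗ[ℝ⟦X⟧] G) (M : P →ₗ[ℝ⟦X⟧] G)
    (L : P →ₗ[ℝ⟦X⟧] (SCross ρ)⟦X⟧) (hML : ∀ p, M p = 0 → L p = 0)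
    (h : ∀ a : SCross ρ, ∃ p, M p = Ψ (1 ⊗ₜ a) ∧ L p = PowerSeries.C a) :
    Function.Injective Ψ := by
  let β := Module.Basis.ofVectorSpace ℝ (SCross ρ)
  let B := Algebra.TensorProduct.basis ℝ⟦X⟧ β
  -- The chosen lifts need not be linear in `a`; only those of the elements of the basis `β` are
  -- used, extended by linearity.
  choose p hpM hpL using h
  rw [← LinearMap.ker_eq_bot, LinearMap.ker_eq_bot']
  intro z hz
  have hsum : ∑ i ∈ (B.repr z).support, B.repr z i • B i = z := by
    conv_rhs => rw [← B.linearCombination_repr z, Finsupp.linearCombination_apply, Finsupp.sum]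
  have h0 : M (∑ i ∈ (B.repr z).support, B.repr z i • p (β i)) = 0 := by
    rw [← hz]
    conv_rhs => rw [← hsum]
    simp only [map_sum, map_smul, hpM]
    refine Finset.sum_congr rfl fun i _ => ?_
    rw [Algebra.TensorProduct.basis_apply]
  have h1 := hML _ h0
  simp only [map_sum, map_smul, hpL] at h1
  suffices hr : ∀ j, B.repr z j = 0 by
    rw [← hsum]
    exact Finset.sum_eq_zero fun i _ => by rw [hr, zero_smul]
  intro j
  ext1 m
  have h2 := congrArg (fun f => β.repr (PowerSeries.coeff m f) j) h1
  have h3 : ∀ i, PowerSeries.coeff m (B.repr z i • PowerSeries.C (β i)) =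
      PowerSeries.coeff m (B.repr z i) • β i := by
    intro i
    rw [coeff_series_smul, Finset.sum_eq_single (m, 0)]
    · simp
    · rintro ⟨a, c⟩ hac hne
      rw [Finset.HasAntidiagonal.mem_antidiagonal] at hac
      have hc : c ≠ 0 := fun h => hne (by simp_all)
      simp [PowerSeries.coeff_C, hc]
    · intro h
      exact absurd (Finset.HasAntidiagonal.mem_antidiagonal.mpr (add_zero m)) h
  simp only [map_sum, h3, map_smul, Module.Basis.repr_self, map_zero, Finsupp.coe_zero,
    Pi.zero_apply, Finsupp.finsetSum_apply, Finsupp.smul_apply, smul_eq_mul] at h2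
  rw [Finset.sum_eq_single j (fun i _ hij => by rw [Finsupp.single_eq_of_ne hij.symm, mul_zero])
    (fun hj => by rw [Finsupp.notMem_support_iff.mp hj, map_zero, zero_mul]),
    Finsupp.single_eq_same, mul_one] at h2
  rw [h2, map_zero]

/-! ### Homogeneous components -/

section Top

variable {ι : Type*} [LinearOrder ι] (b : Module.Basis ι ℝ (Module.Dual ℝ V))

/-- The homogeneous component of degree `n` of elements of `S(V*)`. -/
def SDual.component (n : ℕ) : SDual ρ →ₗ[ℝ] SDual ρ :=
  (SDual.monomialBasis ρ b).constr ℝ fun m =>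
    if (Finsupp.toMultiset m).card = n then SDual.monomialBasis ρ b m else 0

/-- The homogeneous component of degree `n` of elements of `S(V*) ⋊ Γ`. -/
def SCross.component (n : ℕ) : SCross ρ →ₗ[ℝ] SCross ρ :=
  extendRight (inclCross ∘ₗ SDual.component b n)

lemma SCross.component_word (n : ℕ) (w : List ι) (γ : Γ) :
    SCross.component b n (TCross.proj ρ (TCross.word ρ b w * TCross.grp ρ γ)) =
      if w.length = n then TCross.proj ρ (TCross.word ρ b w * TCross.grp ρ γ) else 0 := by
  have h : SDual.component b n (TDual.toSDual ρ (TDual.word ρ b w)) =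
      if w.length = n then TDual.toSDual ρ (TDual.word ρ b w) else 0 := by
    rw [TDual.toSDual_word, SDual.component, Module.Basis.constr_basis,
      Multiset.toFinsupp_toMultiset, Multiset.coe_card]
  rw [TCross.word_mul_grp, TCross.proj_single, SCross.component, extendRight_single]
  change SkewMonoidAlgebra.single 1 _ * _ = _
  rw [h, single_mul_single_one, one_mul]
  split_ifs
  · rfl
  · exact SkewMonoidAlgebra.single_zero γ

lemma SCross.component_proj_eq_zero {m n : ℕ} (h : n < m) {t : TCross ρ}
    (ht : t ∈ TCross.wordsLE ρ n) : SCross.component b m (TCross.proj ρ t) = 0 := by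
  have : TCross.wordsLE ρ n ≤ LinearMap.ker (SCross.component b m ∘ₗ TCross.proj ρ) := by
    refine TCross.wordsLE_le ρ b fun γ w hw => ?_
    rw [LinearMap.mem_ker, LinearMap.comp_apply, ← TCross.word_mul_grp, SCross.component_word,
      if_neg (by omega)]
  exact this ht

end Top

end

/-! ### The associated graded algebra, computed by leading terms. -/

section

variable {Γ V : Type*} [Group Γ] [Fintype Γ] [AddCommGroup V] [Module ℝ V] [FiniteDimensional ℝ V]
  {ρ : Representation ℝ Γ V}

/-! ### Leading terms of normal forms -/

namespace NormalForm

variable {π : ConstantPoisson ρ} {s : EquivariantSection ρ} (ν : NormalForm π s)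
  {ι : Type*} [LinearOrder ι] (b : Module.Basis ι ℝ (Module.Dual ℝ V))

/-- Each step from `N k` to `N (k + 1)` replaces a commutator by an element of length zero, so `N k`
lowers the degree by at least `2 * k`. -/
lemma component_eq_zero (k : ℕ) : ∀ {m n : ℕ}, n < m + 2 * k → ∀ {t : TCross ρ},
    t ∈ TCross.wordsLE ρ n → SCross.component b m (ν.N k t) = 0 := by
  induction k with
  | zero =>
    intro m n h t ht
    rw [ν.zero, SCross.component_proj_eq_zero b (by omega) ht]
  | succ k ih =>
    intro m n h t ht
    have key : TCross.commSpan ρ n ≤ LinearMap.ker (SCross.component b m ∘ₗ ν.N (k + 1)) := by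
      refine Submodule.span_le.mpr ?_
      rintro _ ⟨i, j, f, g, x, y, hf, hg, hij, rfl⟩
      change SCross.component b m (ν.N (k + 1) _) = 0
      rw [ν.succ_comm]
      exact ih (n := i + 0 + j) (by omega) (TCross.mul_mem_wordsLE ρ
        (TCross.mul_mem_wordsLE ρ hf (π.valueLin_mem_wordsLE x y)) hg)
    have h1 : SCross.component b m (ν.N (k + 1) _) = 0 := key (s.sub_mem ht)
    rwa [map_sub, ν.succ_toLin, sub_zero] at h1

lemma component_series_eq_zero {m n : ℕ} (h : n < m) {f : (TCross ρ)⟦X⟧}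
    (hf : f ∈ seriesWordsLE ρ n) : coeffMap (SCross.component b m) (ν.series f) = 0 := by
  ext1 i
  rw [coeff_coeffMap, series, coeff_seriesMap, map_sum, map_zero]
  exact Finset.sum_eq_zero fun p _ => ν.component_eq_zero b p.1 (by omega) (hf p.2)

/-- In the top degree only `N₀`, the projection, contributes. -/
lemma component_series_C {n : ℕ} {t : TCross ρ} (ht : t ∈ TCross.wordsLE ρ n) :
    coeffMap (SCross.component b n) (ν.series (PowerSeries.C t)) =
      PowerSeries.C (SCross.component b n (TCross.proj ρ t)) := by
  ext1 i
  rw [coeff_coeffMap, series, coeff_seriesMap_C, PowerSeries.coeff_C]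
  split_ifs with h
  · rw [h, ν.zero]
  · exact ν.component_eq_zero b i (by omega) ht

end NormalForm

/-! ### The PBW property -/

section PBW

variable (J : TwoSidedIdeal (TCross ρ)⟦X⟧)

/-- The class of `t` in the degree `n` part of the filtration. -/
def wordClass {n : ℕ} {t : TCross ρ} (ht : t ∈ TCross.wordsLE ρ n) : (wordFiltration J).deg n :=
  ⟨QuotAlg.mk J (PowerSeries.C t), _, C_mem_seriesWordsLE ht, rfl⟩

lemma symbolVec_eq (x : Module.Dual ℝ V) :
    symbolVec J x = (wordFiltration J).symbol 1 (wordClass J (TCross.vec_mem ρ x)) := rfl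

lemma symbolGrp_eq (γ : Γ) :
    symbolGrp J γ = (wordFiltration J).symbol 0 (wordClass J (TCross.grp_mem ρ γ)) := rfl

lemma symbol_wordClass_congr {n : ℕ} {t u : TCross ρ} (ht : t ∈ TCross.wordsLE ρ n)
    (hu : u ∈ TCross.wordsLE ρ n) (h : t = u) : (wordFiltration J).symbol n (wordClass J ht) =
      (wordFiltration J).symbol n (wordClass J hu) := by
  subst h
  rfl

lemma symbol_wordClass_mul {m n l : ℕ} {f g t : TCross ρ} (hf : f ∈ TCross.wordsLE ρ m)
    (hg : g ∈ TCross.wordsLE ρ n) (ht : t ∈ TCross.wordsLE ρ l) (hl : m + n = l) (h : t = f * g) :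
    (wordFiltration J).symbol m (wordClass J hf) * (wordFiltration J).symbol n (wordClass J hg) =
      (wordFiltration J).symbol l (wordClass J ht) :=
  (wordFiltration J).symbol_mul_symbol _ _ _ hl (by
    change QuotAlg.mk J (PowerSeries.C t) =
      QuotAlg.mk J (PowerSeries.C f) * QuotAlg.mk J (PowerSeries.C g)
    rw [h, map_mul, map_mul])

lemma symbolGrp_mul (γ δ : Γ) : symbolGrp J (γ * δ) = symbolGrp J γ * symbolGrp J δ := by
  rw [symbolGrp_eq J γ, symbolGrp_eq J δ, symbol_wordClass_mul J _ _ (TCross.grp_mem ρ (γ * δ)) rfl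
    (TCross.grp_mul_grp ρ γ δ).symm, symbolGrp_eq]

lemma symbolGrp_one : symbolGrp J 1 = 1 :=
  (wordFiltration J).symbol_one _ (by
    change QuotAlg.mk J (PowerSeries.C (TCross.grp ρ 1)) = 1
    rw [TCross.grp_one, map_one, map_one])

lemma symbolGrp_mul_symbolVec (γ : Γ) (x : Module.Dual ℝ V) :
    symbolGrp J γ * symbolVec J x = symbolVec J (ρ.dual γ x) * symbolGrp J γ := by
  have h : TCross.grp ρ γ * TCross.vec ρ x ∈ TCross.wordsLE ρ 1 :=
    TCross.mul_mem_wordsLE ρ (TCross.grp_mem ρ γ) (TCross.vec_mem ρ x)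
  rw [symbolGrp_eq, symbolVec_eq, symbolVec_eq, symbol_wordClass_mul J _ _ h rfl rfl,
    symbol_wordClass_mul J _ _ h rfl (TCross.grp_mul_vec ρ γ x)]

variable {J} {π : ConstantPoisson ρ} (hJ : π.relIdeal ≤ J)

include hJ in
lemma mk_comm (x y : Module.Dual ℝ V) : QuotAlg.mk J (PowerSeries.C (TCross.comm ρ x y)) =
    (PowerSeries.X : ℝ⟦X⟧) • QuotAlg.mk J (PowerSeries.C (π.valueLin x y)) := by
  rw [← map_smul, ← X_mul_eq_smul, QuotAlg.mk_eq_mk_iff]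
  refine hJ (TwoSidedIdeal.subset_span ⟨x, y, ?_⟩)
  rw [π.value_eq_valueLin, TCross.comm_apply]

-- The commutator is `ħ π(x, y)`, of length zero, so it lies below degree two and has zero symbol
-- there.
include hJ in
lemma symbolVec_commute (x y : Module.Dual ℝ V) :
    symbolVec J x * symbolVec J y = symbolVec J y * symbolVec J x := by
  have h : ∀ x y, TCross.vec ρ x * TCross.vec ρ y ∈ TCross.wordsLE ρ 2 := fun x y =>
    TCross.mul_mem_wordsLE ρ (TCross.vec_mem ρ x) (TCross.vec_mem ρ y)
  rw [symbolVec_eq, symbolVec_eq, symbol_wordClass_mul J _ _ (h x y) rfl rfl,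
    symbol_wordClass_mul J _ _ (h y x) rfl rfl, ← sub_eq_zero, ← AlgFiltration.toGr_monomial,
    ← AlgFiltration.toGr_monomial, ← map_sub, ← map_sub]
  refine AlgFiltration.symbol_eq_zero _ _ ?_
  have h1 : QuotAlg.mk J (PowerSeries.C (TCross.comm ρ x y)) ∈ (wordFiltration J).deg 1 := by
    rw [mk_comm hJ]
    exact Submodule.smul_mem _ _ ⟨_, C_mem_seriesWordsLE
      (TCross.wordsLE_mono ρ zero_le_one (π.valueLin_mem_wordsLE x y)), rfl⟩
  rwa [TCross.comm_apply, map_sub, map_sub] at h1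

include hJ in
lemma exists_hom_gr (s : EquivariantSection ρ) :
    ∃ Ψ : ℝ⟦X⟧ ⊗[ℝ] SCross ρ →ₐ[ℝ⟦X⟧] (wordFiltration J).Gr,
      (∀ x, Ψ (1 ⊗ₜ SCross.vec ρ x) = symbolVec J x) ∧
      ∀ γ, Ψ (1 ⊗ₜ SCross.grp ρ γ) = symbolGrp J γ := by
  refine exists_baseChange_hom s (symbolVec J) (fun x y => ?_) (fun r x => ?_)
    { toFun := symbolGrp J
      map_one' := symbolGrp_one J
      map_mul' := symbolGrp_mul J } (symbolGrp_mul_symbolVec J) (symbolVec_commute hJ)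
  · have h : wordClass J (TCross.vec_mem ρ (x + y)) =
        wordClass J (TCross.vec_mem ρ x) + wordClass J (TCross.vec_mem ρ y) := by
      refine Subtype.ext ?_
      change QuotAlg.mk J (PowerSeries.C (TCross.vec ρ (x + y))) =
        QuotAlg.mk J (PowerSeries.C (TCross.vec ρ x)) +
          QuotAlg.mk J (PowerSeries.C (TCross.vec ρ y))
      rw [← map_add, ← map_add, TCross.vec, map_add, SkewMonoidAlgebra.single_add]
      rfl
    rw [symbolVec_eq, h, ← AlgFiltration.toGr_monomial, map_add, map_add]
    rfl
  · have h : wordClass J (TCross.vec_mem ρ (r • x)) =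
        (PowerSeries.C r : ℝ⟦X⟧) • wordClass J (TCross.vec_mem ρ x) := by
      refine Subtype.ext ?_
      change QuotAlg.mk J (PowerSeries.C (TCross.vec ρ (r • x))) =
        (PowerSeries.C r : ℝ⟦X⟧) • QuotAlg.mk J (PowerSeries.C (TCross.vec ρ x))
      rw [← map_smul, TCross.vec, map_smul, ← SkewMonoidAlgebra.smul_single, series_smul_def,
        PowerSeries.map_C, TCross.vec, ← map_mul, ← Algebra.smul_def]
    rw [symbolVec_eq, h, ← AlgFiltration.toGr_monomial, map_smul, map_smul]
    rfl

variable {ι : Type*} (b : Module.Basis ι ℝ (Module.Dual ℝ V))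
  {Ψ : ℝ⟦X⟧ ⊗[ℝ] SCross ρ →ₐ[ℝ⟦X⟧] (wordFiltration J).Gr}
  (hv : ∀ x, Ψ (1 ⊗ₜ SCross.vec ρ x) = symbolVec J x)
  (hg : ∀ γ, Ψ (1 ⊗ₜ SCross.grp ρ γ) = symbolGrp J γ)

lemma TCross.word_mul_grp_mem (w : List ι) (γ : Γ) :
    TCross.word ρ b w * TCross.grp ρ γ ∈ TCross.wordsLE ρ w.length :=
  TCross.mul_mem_wordsLE ρ (TCross.word_mem_wordsLE ρ b w) (TCross.grp_mem ρ γ)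

include hv hg in
lemma hom_gr_word (w : List ι) (γ : Γ) :
    Ψ (1 ⊗ₜ TCross.proj ρ (TCross.word ρ b w * TCross.grp ρ γ)) =
      (wordFiltration J).symbol w.length (wordClass J (TCross.word_mul_grp_mem b w γ)) := by
  induction w with
  | nil =>
    have h : TCross.word ρ b [] * TCross.grp ρ γ = TCross.grp ρ γ := by
      rw [TCross.word_nil, one_mul]
    refine (congrArg (fun t => Ψ (1 ⊗ₜ TCross.proj ρ t)) h).trans ?_
    rw [TCross.proj_grp, hg, symbolGrp_eq]
    exact symbol_wordClass_congr J _ _ h.symm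
  | cons i w ih =>
    have h : TCross.word ρ b (i :: w) * TCross.grp ρ γ =
        TCross.vec ρ (b i) * (TCross.word ρ b w * TCross.grp ρ γ) := by
      rw [TCross.word_cons, mul_assoc]
    refine (congrArg (fun t => Ψ (1 ⊗ₜ TCross.proj ρ t)) h).trans ?_
    rw [TCross.proj_mul, TCross.proj_vec, ← one_mul (1 : ℝ⟦X⟧),
      ← Algebra.TensorProduct.tmul_mul_tmul, map_mul, hv, ih, symbolVec_eq]
    exact symbol_wordClass_mul J _ _ _ (by rw [List.length_cons, add_comm]) h

-- A word of length exactly `n` has its symbol in the image by `hom_gr_word`, and a shorter word has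
-- zero symbol in degree `n`. `seriesWordsLE_le_span` passes from words to series.
include hv hg in
lemma hom_gr_surjective : Function.Surjective Ψ := by
  let b := Module.finBasis ℝ (Module.Dual ℝ V)
  have key : ∀ n (a : (wordFiltration J).deg n),
      (wordFiltration J).symbol n a ∈ LinearMap.range Ψ.toLinearMap := by
    intro n
    -- The series whose class lies in the degree `n` part and has its symbol in the image of `Ψ`.
    let U : Submodule ℝ⟦X⟧ (TCross ρ)⟦X⟧ :=
      (((LinearMap.range Ψ.toLinearMap).comap (((wordFiltration J).toGr.toLinearMap) ∘ₗ
        (wordFiltration J).monomial n)).map ((wordFiltration J).deg n).subtype).comap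
          (QuotAlg.mk J).toLinearMap
    have hU : ∀ t ∈ TCross.wordsLE ρ n, PowerSeries.C t ∈ U := by
      let U' : Submodule ℝ (TCross ρ) :=
        { carrier := {t | PowerSeries.C t ∈ U}
          zero_mem' := by
            change PowerSeries.C 0 ∈ U
            rw [map_zero]; exact U.zero_mem
          add_mem' := fun {x y} hx hy => by
            change PowerSeries.C (x + y) ∈ U
            rw [map_add]; exact U.add_mem hx hy
          smul_mem' := fun c x hx => by
            change PowerSeries.C (c • x) ∈ U
            have : PowerSeries.C (c • x) = (PowerSeries.C c : ℝ⟦X⟧) • (PowerSeries.C x) := by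
              rw [series_smul_def, PowerSeries.map_C, ← map_mul, ← Algebra.smul_def]
            rw [this]
            exact U.smul_mem _ hx }
      have hle : TCross.wordsLE ρ n ≤ U' := by
        refine TCross.wordsLE_le ρ b fun γ w hw => ?_
        rw [← TCross.word_mul_grp]
        refine ⟨wordClass J (TCross.wordsLE_mono ρ hw (TCross.word_mul_grp_mem b w γ)), ?_, rfl⟩
        change (wordFiltration J).symbol n _ ∈ LinearMap.range Ψ.toLinearMap
        rcases hw.eq_or_lt with rfl | hlt
        · exact ⟨_, hom_gr_word b hv hg w γ⟩
        · rw [AlgFiltration.symbol_eq_zero]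
          · exact Submodule.zero_mem _
          · obtain ⟨n, rfl⟩ : ∃ m, n = m + 1 := ⟨n - 1, by omega⟩
            exact (wordClass J (TCross.wordsLE_mono ρ (Nat.le_of_lt_succ hlt)
              (TCross.word_mul_grp_mem b w γ))).2
      exact fun t ht => hle ht
    rintro ⟨_, f, hf, rfl⟩
    have hfU : f ∈ U := by
      refine Submodule.span_le.mpr ?_ (seriesWordsLE_le_span n hf)
      rintro _ ⟨t, ht, rfl⟩
      exact hU t ht
    obtain ⟨a, ha, hfa⟩ := hfU
    have h1 : a = ⟨_, f, hf, rfl⟩ := Subtype.ext hfa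
    rw [← h1]
    exact ha
  intro z
  obtain ⟨p, rfl⟩ := (wordFiltration J).toGr_surjective z
  have : (wordFiltration J).toGr p ∈ LinearMap.range Ψ.toLinearMap := by
    rw [(wordFiltration J).rees_eq_sum p, map_sum]
    exact Submodule.sum_mem _ fun n _ => key n _
  exact this

variable {s : EquivariantSection ρ}

-- The top component of the normal form vanishes on lower filtration degree and returns `a` on a
-- lift of the symbol attached to `a`, so it separates the values of `Ψ`.
include hv hg in
lemma NormalForm.hom_gr_injective (ν : NormalForm π s) (hJν : ∀ f ∈ J, ν.series f = 0) :
    Function.Injective Ψ := by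
  let b := Module.finBasis ℝ (Module.Dual ℝ V)
  obtain ⟨Nq, hNq⟩ : ∃ Nq : QuotAlg J →ₗ[ℝ⟦X⟧] (SCross ρ)⟦X⟧,
      ∀ f, Nq (QuotAlg.mk J f) = ν.series f := by
    let σ := Function.surjInv (QuotAlg.mk_surjective J)
    have hσ : ∀ f, ν.series (σ (QuotAlg.mk J f)) = ν.series f := fun f => by
      rw [← sub_eq_zero, ← map_sub]
      exact hJν _ ((QuotAlg.mk_eq_mk_iff J _ _).mp (Function.surjInv_eq _ _))
    refine ⟨{
      toFun := fun q => ν.series (σ q)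
      map_add' := fun p q => ?_
      map_smul' := fun r q => ?_ }, hσ⟩
    · obtain ⟨f, rfl⟩ := QuotAlg.mk_surjective J p
      obtain ⟨g, rfl⟩ := QuotAlg.mk_surjective J q
      rw [← map_add, hσ, hσ, hσ, map_add]
    · obtain ⟨f, rfl⟩ := QuotAlg.mk_surjective J q
      rw [← map_smul, hσ, hσ, map_smul, RingHom.id_apply]
  -- The coefficient of `tⁿ` in the Rees algebra is sent to the degree `n` component of its normal
  -- form, and the results are added.
  let L : (wordFiltration J).rees →ₗ[ℝ⟦X⟧] (SCross ρ)⟦X⟧ :=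
    Polynomial.lsum (fun n => coeffMap (SCross.component b n) ∘ₗ Nq) ∘ₗ
      (wordFiltration J).rees.val.toLinearMap
  have hL : ∀ n a, L ((wordFiltration J).monomial n a) =
      coeffMap (SCross.component b n) (Nq a) := fun n a => by
    change Polynomial.sum (Polynomial.monomial n (a : QuotAlg J)) _ = _
    exact Polynomial.sum_monomial_index _ _ (map_zero _)
  refine injective_of_relation Ψ.toLinearMap (wordFiltration J).toGr.toLinearMap L ?_ ?_
  · intro p hp
    have hp' := ((wordFiltration J).toGr_eq_zero_iff p).mp hp
    rw [(wordFiltration J).rees_eq_sum p, map_sum]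
    refine Finset.sum_eq_zero fun n _ => ?_
    rw [hL]
    change coeffMap (SCross.component b n) (Nq ((p : Polynomial (QuotAlg J)).coeff n)) = 0
    have hn := hp' n
    cases n with
    | zero =>
      rw [(Submodule.mem_bot _).mp hn, map_zero, map_zero]
    | succ n =>
      obtain ⟨f, hf, hfn⟩ := hn
      rw [← hfn]
      change coeffMap (SCross.component b (n + 1)) (Nq (QuotAlg.mk J f)) = 0
      rw [hNq]
      exact ν.component_series_eq_zero b n.lt_succ_self hf
  · intro a
    obtain ⟨t, rfl⟩ := TCross.proj_surjective ρ a
    -- Having a suitable lift is a condition closed under linear combinations, so words suffice; a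
    -- word of length `n` lifts to its class times `tⁿ`.
    let W : Submodule ℝ (TCross ρ) :=
      { carrier := {t | ∃ p, (wordFiltration J).toGr.toLinearMap p =
          Ψ.toLinearMap (1 ⊗ₜ TCross.proj ρ t) ∧ L p = PowerSeries.C (TCross.proj ρ t)}
        zero_mem' := by
          refine ⟨0, ?_, ?_⟩
          · rw [map_zero, map_zero, TensorProduct.tmul_zero, map_zero]
          · rw [map_zero, map_zero, map_zero]
        add_mem' := by
          rintro x y ⟨p, hp, hp'⟩ ⟨q, hq, hq'⟩
          refine ⟨p + q, ?_, ?_⟩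
          · rw [map_add, map_add, TensorProduct.tmul_add, map_add, hp, hq]
          · rw [map_add, map_add, map_add, hp', hq']
        smul_mem' := by
          rintro c x ⟨p, hp, hp'⟩
          refine ⟨(PowerSeries.C c : ℝ⟦X⟧) • p, ?_, ?_⟩
          · rw [map_smul, hp, ← map_smul, map_smul (TCross.proj ρ), TensorProduct.tmul_smul,
              TensorProduct.smul_tmul', TensorProduct.smul_tmul', smul_eq_mul, mul_one,
              PowerSeries.smul_eq_C_mul, mul_one]
          · rw [map_smul, hp', map_smul, series_smul_def, PowerSeries.map_C, ← map_mul,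
              ← Algebra.smul_def] }
    obtain ⟨n, hn⟩ := TCross.mem_sup_wordsLE ρ t b
    refine (TCross.wordsLE_le ρ b (W := W) fun γ w _ => ?_) hn
    rw [← TCross.word_mul_grp]
    refine ⟨(wordFiltration J).monomial w.length (wordClass J (TCross.word_mul_grp_mem b w γ)),
      (hom_gr_word b hv hg w γ).symm, ?_⟩
    rw [hL]
    change coeffMap (SCross.component b _) (Nq (QuotAlg.mk J _)) = _
    rw [hNq, ν.component_series_C b (TCross.word_mul_grp_mem b w γ), SCross.component_word,
      if_pos rfl]

-- Here `J` may be any ideal between the ideal of relations and the kernel of the normal form.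
include hJ in
lemma NormalForm.hasPBW (ν : NormalForm π s) (hJν : ∀ f ∈ J, ν.series f = 0) : HasPBW J := by
  obtain ⟨Ψ, hv, hg⟩ := exists_hom_gr hJ s
  let e := AlgEquiv.ofBijective Ψ ⟨ν.hom_gr_injective hv hg hJν, hom_gr_surjective hv hg⟩
  refine ⟨e.symm, fun x => ?_, fun γ => ?_⟩
  · rw [AlgEquiv.symm_apply_eq]
    exact (hv x).symm
  · rw [AlgEquiv.symm_apply_eq]
    exact (hg γ).symm

end PBW

end

end OrbifoldPBW

end

theorem mainTheorem2 {Γ V : Type*} [Group Γ] [Fintype Γ] [AddCommGroup V] [Module ℝ V]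
    [FiniteDimensional ℝ V] (ρ : Representation ℝ Γ V) (hρ : Function.Injective ρ)
    (π : OrbifoldPBW.ConstantPoisson ρ) :
    π.IsQuantizable ∧
      OrbifoldPBW.HasPBW π.relIdeal ∧
      OrbifoldPBW.HasPBW (OrbifoldPBW.hbarClosure π.relIdeal) ∧
      π.HIsQuantization := by
  let b := Module.finBasis ℝ (Module.Dual ℝ V)
  let ν := OrbifoldPBW.NormalForm.ofSection π b (OrbifoldPBW.averagedSection ρ b)
  exact ⟨⟨ν.deformation, ν.isQuantizedBy_deformation⟩,
    ν.hasPBW le_rfl fun f hf => ν.series_eq_zero_of_mem (OrbifoldPBW.le_hbarClosure _ hf),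
    ν.hasPBW (OrbifoldPBW.le_hbarClosure _) fun f hf => ν.series_eq_zero_of_mem hf,
    ν.hIsQuantization⟩
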